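/- Theorem 7.1. All trees are finite. For a tree $G=(V,E)$ and $A\subseteq V$ let $d(A)$ (resp. $e(A)$) be the number of edges with exactly one endpoint (resp. both endpoints) in $A$. The half-generalized degree polynomial (HDP) of $G$ is $\mathrm{HDP}_G(y,z)=\sum_A y^{d(A)}z^{e(A)}$, the sum over all nonempty $A\subseteq V$ inducing a connected subgraph. The modified HDP, $\overline{\mathrm{HDP}}_G(y,z)$, is the same sum restricted to those $A$ that contain at least one non-leaf vertex of $G$. A polarized tree is a tree with two marked vertices, its left end and its right end, which may coincide. Let $T,T'$ be polarized trees with left ends $L,L'$ and right ends $R,R'$. The concatenation $T\cdot T'$ is the disjoint union of $T$ and $T'$ with the edge $RL'$ added, with left end $L$ and right end $R'$. The near-concatenation $T\odot T'$ is obtained from $T\cdot T'$ by contracting the edge $RL'$ to a vertex and attaching one new leaf to this vertex; its left and right ends are (the images of) $L$ and $R'$. Let $1$ denote the one-vertex tree, whose vertex is both its left and right end. For $i\ge 1$ let $T^{\odot i}=T\odot\cdots\odot T$ ($i$ factors), and for a composition $\alpha=(a_1,\dots,a_k)$ (a sequence of $k\ge 1$ positive integers) let $\alpha\circ T=T^{\odot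 a_1}\cdot T^{\odot a_2}\cdots T^{\odot a_k}$. For a composition $\alpha$ write $\ell(\alpha)$ for its number of parts and $\alpha^*$ for its reverse. A composition $\gamma$ with the same sum as $\alpha$ is a coarsening of $\alpha$, written $\gamma\ge\alpha$, if every partial sum of $\gamma$ is a partial sum of $\alpha$. Define $$H(\alpha)=\sum_{\gamma\ge\alpha}\frac{y^{\ell(\gamma)-1}z^{\ell(\alpha)-\ell(\gamma)}}{(y+z)^{\ell(\alpha)-1}}\sum_{i=1}^{\ell(\gamma)}x_{\gamma_i}\in\mathbb{Q}(y,z)[x_1,x_2,\dots].$$ For compositions $\alpha=(a_1,\dots,a_k)$ and $\beta=(b_1,\dots,b_m)$ let $\alpha\cdot\beta=(a_1,\dots,a_k,b_1,\dots,b_m)$, $\alpha\odot\beta=(a_1,\dots,a_{k-1},a_k+b_1,b_2,\dots,b_m)$ and $\alpha\circ\beta=\beta^{\odot a_1}\cdots\beta^{\odot a_k}$. A factorization $\alpha=\alpha_1\circ\cdots\circ\alpha_r$ is nontrivial if no $\alpha_i$ is the composition $(1)$, no two consecutive factors both have length $1$, and no two consecutive factors both have all parts equal to $1$. It is irreducible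 if it is nontrivial and no $\alpha_i$ has a nontrivial factorization into two or more factors. (The composition $(1)$ has the empty factorization.) A switch of $\alpha$ is a composition $\beta_1\circ\cdots\circ\beta_r$ where $\alpha_1\circ\cdots\circ\alpha_r$ is the irreducible factorization of $\alpha$ and $\beta_i\in\{\alpha_i,\alpha_i^*\}$ for each $i$. Let $T$ be a polarized tree and $\alpha$ a composition. Then, in $\mathbb{Q}(y,z)$, $$\overline{\mathrm{HDP}}_{1\odot(\alpha\circ T)\odot 1}=H(\alpha)\big|_{x_i=\overline{\mathrm{HDP}}_{1\odot T^{\odot i}\odot 1}\ (i\ge 1)}.$$ Moreover, if $\beta$ is a switch of $\alpha$, then $$\mathrm{HDP}_{1\odot(\alpha\circ T)\odot 1}=\mathrm{HDP}_{1\odot(\beta\circ T)\odot 1}.$$ -/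

import Mathlib

universe u

namespace TreeHDP

/-! ### Half-generalized degree polynomials -/

section Polynomials

variable {V : Type u} [Fintype V]

/-- `d(A)`: the number of edges of `G` with exactly one endpoint in `A`. -/
noncomputable def extEdges (G : SimpleGraph V) (A : Finset V) : ℕ :=
  {e ∈ G.edgeSet | ∃! v, v ∈ e ∧ v ∈ A}.ncard

/-- `e(A)`: the number of edges of `G` with both endpoints in `A`. -/
noncomputable def intEdges (G : SimpleGraph V) (A : Finset V) : ℕ :=
  {e ∈ G.edgeSet | ∀ v ∈ e, v ∈ A}.ncard

/-- `v` is a leaf of `G`: it has exactly one neighbour. -/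
def IsLeaf (G : SimpleGraph V) (v : V) : Prop :=
  (G.neighborSet v).ncard = 1

/-- The monomial `y ^ d(A) * z ^ e(A)` in `ℤ[y, z]`; the variable `0` is `y`, the variable `1`
is `z`. -/
noncomputable def subtreeMonomial (G : SimpleGraph V) (A : Finset V) : MvPolynomial (Fin 2) ℤ :=
  MvPolynomial.X 0 ^ extEdges G A * MvPolynomial.X 1 ^ intEdges G A

open Classical in
/-- The half-generalized degree polynomial: the sum of `y ^ d(A) * z ^ e(A)` over the nonempty
vertex sets `A` that induce a connected subgraph. -/
noncomputable def hdp (G : SimpleGraph V) : MvPolynomial (Fin 2) ℤ :=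
  ∑ A ∈ Finset.univ.filter (fun A : Finset V =>
      A.Nonempty ∧ (G.induce (A : Set V)).Connected),
    subtreeMonomial G A

open Classical in
/-- The modified half-generalized degree polynomial: only the vertex sets that contain at least
one non-leaf vertex of `G` are taken. -/
noncomputable def modifiedHdp (G : SimpleGraph V) : MvPolynomial (Fin 2) ℤ :=
  ∑ A ∈ Finset.univ.filter (fun A : Finset V =>
      (A.Nonempty ∧ (G.induce (A : Set V)).Connected) ∧ ∃ v ∈ A, ¬ IsLeaf G v),
    subtreeMonomial G A

end Polynomials

/-! ### Polarized trees -/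

/-- The near-contraction of the edge `vw`: every edge `wx` with `x ∉ {v, w}` is replaced by `vx`.
In other words, `vw` is contracted to a vertex that keeps the name `v`, and a new leaf `w` is
attached to it. -/
def nearContraction {V : Type u} (G : SimpleGraph V) (v w : V) : SimpleGraph V :=
  SimpleGraph.fromEdgeSet
    ((G.edgeSet \ {e | ∃ x, x ≠ v ∧ x ≠ w ∧ e = s(w, x)}) ∪
      {e | ∃ x, x ≠ v ∧ x ≠ w ∧ s(w, x) ∈ G.edgeSet ∧ e = s(v, x)})

/-- A finite graph with two distinguished vertices, its left end and its right end, which may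
coincide. It is a polarized tree if `graph.IsTree`. -/
structure PolarizedGraph where
  V : Type u
  fintypeV : Fintype V
  graph : SimpleGraph V
  left : V
  right : V

attribute [instance] PolarizedGraph.fintypeV

namespace PolarizedGraph

/-- The one-vertex tree `1`; its only vertex is both its left and its right end. -/
def one : PolarizedGraph.{u} where
  V := PUnit
  fintypeV := inferInstance
  graph := ⊥
  left := PUnit.unit
  right := PUnit.unit

/-- The concatenation `S · T`: the disjoint union together with an edge from the right end of `S`
to the left end of `T`. -/
def concat (S T : PolarizedGraph.{u}) : PolarizedGraph.{u} where
  V := S.V ⊕ T.V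
  fintypeV := inferInstance
  graph := (S.graph ⊕g T.graph) ⊔ SimpleGraph.edge (Sum.inl S.right) (Sum.inr T.left)
  left := Sum.inl S.left
  right := Sum.inr T.right

open Classical in
/-- The near-concatenation `S ⊙ T`: the near-contraction, in `S · T`, of the edge that joins the
right end of `S` to the left end of `T`. The ends are those of `S · T`, where an end of the
contracted edge is to be read as the vertex to which this edge is contracted, whose name
is `Sum.inl S.right`. -/
noncomputable def nearConcat (S T : PolarizedGraph.{u}) : PolarizedGraph.{u} where
  V := S.V ⊕ T.V
  fintypeV := inferInstance
  graph := nearContraction (S.concat T).graph (Sum.inl S.right) (Sum.inr T.left)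
  left := Sum.inl S.left
  right := if T.right = T.left then Sum.inl S.right else Sum.inr T.right

/-- `T ⊙ T ⊙ ⋯ ⊙ T` with `i` factors. -/
noncomputable def nearPow (T : PolarizedGraph.{u}) (i : ℕ+) : PolarizedGraph.{u} :=
  PNat.recOn i T (fun _ S => S.nearConcat T)

/-- `α ∘ T = T^{⊙ a₁} · T^{⊙ a₂} · ⋯ · T^{⊙ aₖ}` for a composition `α = (a₁, …, aₖ)` with `k ≥ 1`
(the value at the empty list is irrelevant). -/
noncomputable def compose (T : PolarizedGraph.{u}) : List ℕ+ → PolarizedGraph.{u}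
  | [] => one
  | [a] => T.nearPow a
  | a :: b :: l => (T.nearPow a).concat (compose T (b :: l))

/-- `1 ⊙ T ⊙ 1`. -/
noncomputable def framed (T : PolarizedGraph.{u}) : PolarizedGraph.{u} :=
  (one.nearConcat T).nearConcat one

end PolarizedGraph

/-! ### Compositions: nonempty lists of positive integers -/

/-- The integer of which `α` is a composition. -/
def size (α : List ℕ+) : ℕ := (α.map PNat.val).sum

/-- The partial sums of `α`, including `0` and `size α`. -/
def partialSums (α : List ℕ+) : Set ℕ := {s | ∃ j, s = size (α.take j)}

/-- `γ` is a coarsening of `α`. -/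
def IsCoarsening (γ α : List ℕ+) : Prop :=
  size γ = size α ∧ partialSums γ ⊆ partialSums α

theorem finite_size_le (n : ℕ) : {γ : List ℕ+ | size γ ≤ n}.Finite := by
  induction n with
  | zero =>
    refine (Set.finite_singleton []).subset ?_
    intro γ hγ
    cases γ with
    | nil => rfl
    | cons a l =>
      have h1 : 0 < (a : ℕ) := a.2
      simp [size] at hγ
  | succ n ih =>
    refine ((Set.finite_singleton []).union
      (((Set.finite_Iic (⟨n + 1, n.succ_pos⟩ : ℕ+)).image2 List.cons ih))).subset ?_
    intro γ hγ
    cases γ with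
    | nil => exact Or.inl rfl
    | cons a l =>
      have h1 : 0 < (a : ℕ) := a.2
      have h2 : size (a :: l) ≤ n + 1 := hγ
      have h3 : size (a :: l) = (a : ℕ) + size l := rfl
      refine Or.inr ⟨a, ?_, l, ?_, rfl⟩
      · change (a : ℕ) ≤ n + 1
        omega
      · change size l ≤ n
        omega

theorem finite_coarsenings (α : List ℕ+) : {γ | IsCoarsening γ α}.Finite :=
  (finite_size_le (size α)).subset fun _ h => h.1.le

/-- The field `ℚ(y, z)`, as the fraction field of `ℤ[y, z]`. -/
abbrev RatYZ : Type := FractionRing (MvPolynomial (Fin 2) ℤ)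

/-- A polynomial in `y, z` as an element of `ℚ(y, z)`. -/
noncomputable def toRat (p : MvPolynomial (Fin 2) ℤ) : RatYZ :=
  algebraMap (MvPolynomial (Fin 2) ℤ) RatYZ p

/-- The variable `y` in `ℚ(y, z)`. -/
noncomputable def yRat : RatYZ := toRat (MvPolynomial.X 0)

/-- The variable `z` in `ℚ(y, z)`. -/
noncomputable def zRat : RatYZ := toRat (MvPolynomial.X 1)

/-- `H(α)`, a polynomial in `x₁, x₂, …` over `ℚ(y, z)`: the sum, over all coarsenings `γ` of `α`,
of `y ^ (ℓ(γ) - 1) * z ^ (ℓ(α) - ℓ(γ)) / (y + z) ^ (ℓ(α) - 1)` times the sum of the variables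
indexed by the parts of `γ`. The exponents are true differences if `α` is nonempty. -/
noncomputable def H (α : List ℕ+) : MvPolynomial ℕ+ RatYZ :=
  ∑ γ ∈ (finite_coarsenings α).toFinset,
    MvPolynomial.C (yRat ^ (γ.length - 1) * zRat ^ (α.length - γ.length) / (yRat + zRat) ^ (α.length - 1)) *
      (γ.map MvPolynomial.X).sum

/-! ### Factorizations of compositions, and switching -/

/-- The near-concatenation `(a₁, …, aₖ) ⊙ (b₁, …, bₘ) = (a₁, …, aₖ + b₁, …, bₘ)`. -/
def nearConcat : List ℕ+ → List ℕ+ → List ℕ+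
  | [], β => β
  | [a], [] => [a]
  | [a], b :: β => (a + b) :: β
  | a :: a' :: α, β => a :: nearConcat (a' :: α) β

/-- `β ⊙ β ⊙ ⋯ ⊙ β` with `i` factors. -/
def nearPow (β : List ℕ+) (i : ℕ+) : List ℕ+ :=
  PNat.recOn i β (fun _ γ => nearConcat γ β)

/-- `α ∘ β = β^{⊙ a₁} · β^{⊙ a₂} · ⋯ · β^{⊙ aₖ}` for `α = (a₁, …, aₖ)`. -/
def compose (α β : List ℕ+) : List ℕ+ :=
  α.flatMap (nearPow β)

/-- `α₁ ∘ α₂ ∘ ⋯ ∘ αₖ`. The composition `(1)` is a two-sided identity of the associative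
operation `∘`, and the value for `k = 0`. -/
def composeAll (F : List (List ℕ+)) : List ℕ+ :=
  F.foldr compose [1]

/-- The list of factors `F` is nontrivial: its members are compositions other than `(1)`, no two
consecutive ones both have length `1`, and no two consecutive ones both have all parts
equal to `1`. -/
def NontrivialFactors (F : List (List ℕ+)) : Prop :=
  (∀ α ∈ F, α ≠ [] ∧ α ≠ [1]) ∧
  F.IsChain (fun α β => ¬ (α.length = 1 ∧ β.length = 1) ∧
    ¬ ((∀ a ∈ α, a = 1) ∧ (∀ b ∈ β, b = 1)))

/-- `α` has no nontrivial factorization into two or more factors. -/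
def IsIrreducible (α : List ℕ+) : Prop :=
  ¬ ∃ F : List (List ℕ+), 2 ≤ F.length ∧ NontrivialFactors F ∧ composeAll F = α

/-- `F` is the list of factors of an irreducible factorization of `α`. -/
def IsIrreducibleFactorization (F : List (List ℕ+)) (α : List ℕ+) : Prop :=
  composeAll F = α ∧ NontrivialFactors F ∧ ∀ φ ∈ F, IsIrreducible φ

/-- `β` is a switch of `α`: it is obtained from an irreducible factorization of `α` when some of
the factors are replaced by their reverses. -/
def IsSwitch (α β : List ℕ+) : Prop :=
  ∃ F G : List (List ℕ+), IsIrreducibleFactorization F α ∧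
    List.Forall₂ (fun φ ψ => ψ = φ ∨ ψ = φ.reverse) F G ∧ composeAll G = β

end TreeHDP

open TreeHDP

namespace TreeHDP

/-! ### Connected vertex sets of a tree -/

/-! For a polarized tree `S` let `S.ends p q` be the sum of `y^d(A) z^e(A)` over all subtrees `A`,
with a factor `p` if `A` contains the left end and `q` if it contains the right end. This is affine
in `p` and in `q`, and the end sums of `S` and `T` determine those of `S · T` and `S ⊙ T`
(`ends_concat`, `ends_nearConcat`). A framing leaf at an end that lies in `A` is outside `A` (factor
`y`) or inside (factor `z`), so the HDP of `1 ⊙ S ⊙ 1` is `S.ends (y+z) (y+z) + 2y`, where `2y`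
comes from the two framing leaves alone. The subtrees without a non-leaf are the single leaves, each
of weight `y`; hence the modified HDP, `M(S)`, is `S.ends (y+z) (y+z)` minus `y` for each leaf of
`S` that is not an end. Comparing the formulas for `·` and `⊙` gives `(y+z) M(S · T) = y (M(S) +
M(T)) + z M(S ⊙ T)` (`modifiedHdp_framed_concat`).

`H` obeys the same recursion (`isRibbonLike_eval_H`): sort the coarsenings by whether they keep the
first cut. The recursion lowers the number of parts, so its solutions are determined by their values
at one-part compositions. This is the first claim.

A solution `f` satisfies the recursion at every cut, so it is invariant under reversal; moreover `α
↦ f (α ∘ β)` is again a solution. Hence `H(α ∘ β)` is `H(α)` with `x_i` replaced by `H(β^{⊙i})`, and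
`H(α ∘ β*) = H((α* ∘ β)*) = H(α* ∘ β) = H(α ∘ β)`. So factors can be reversed one at a time. The HDP
exceeds the modified one by `y` times the number of leaves, which depends on `α` only through its
sum and its number of parts; a switch preserves both. -/

theorem card_edgeSet_add_one_le_of_isAcyclic {W : Type*} [Finite W] [Nonempty W]
    {G : SimpleGraph W} (h : G.IsAcyclic) :
    G.edgeSet.ncard + 1 ≤ Nat.card W ∧ (G.Connected ↔ G.edgeSet.ncard + 1 = Nat.card W) := by
  -- Extend the forest to a spanning tree `F`; then `G` is connected exactly if no edge had to be
  -- added.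
  obtain ⟨F, hGF, -, hF⟩ :=
    (SimpleGraph.connected_top (V := W)).exists_isTree_le_of_le_of_isAcyclic le_top h
  have hcard : F.edgeSet.ncard + 1 = Nat.card W :=
    (SimpleGraph.isTree_iff_connected_and_card.mp hF).2
  have hle : G.edgeSet ⊆ F.edgeSet := SimpleGraph.edgeSet_subset_edgeSet.mpr hGF
  have hle' := Set.ncard_le_ncard hle (Set.toFinite _)
  refine ⟨by omega, fun hc => (SimpleGraph.isTree_iff_connected_and_card.mp ⟨hc, h⟩).2,
    fun he => ?_⟩
  have heq : G.edgeSet = F.edgeSet :=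
    Set.eq_of_subset_of_ncard_le hle (by omega) (Set.toFinite _)
  rw [SimpleGraph.edgeSet_inj.mp heq]
  exact hF.1

variable {V : Type u}

theorem ncard_edgeSet_induce (G : SimpleGraph V) (A : Finset V) :
    (G.induce (A : Set V)).edgeSet.ncard = intEdges G A := by
  rw [intEdges, ← Set.ncard_image_of_injective _ (Sym2.map.injective Subtype.val_injective)]
  congr 1
  ext e
  induction e with
  | h x y =>
    constructor
    · rintro ⟨e', he', hee⟩
      induction e' with
      | h a b =>
        rw [← hee]
        refine ⟨he', ?_⟩
        simp
    · rintro ⟨hadj, hA⟩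
      simp only [Sym2.mem_iff, forall_eq_or_imp, forall_eq] at hA
      exact ⟨s(⟨x, hA.1⟩, ⟨y, hA.2⟩), hadj, rfl⟩

theorem intEdges_add_one_le [Fintype V] {G : SimpleGraph V} (hG : G.IsTree) {A : Finset V}
    (hA : A.Nonempty) : intEdges G A + 1 ≤ A.card := by
  have : Nonempty (A : Set V) := hA.to_subtype
  have h := (card_edgeSet_add_one_le_of_isAcyclic (hG.2.induce (A : Set V))).1
  rwa [ncard_edgeSet_induce, Nat.card_coe_set_eq, Set.ncard_coe_finset] at h

/-- Trades connectivity for a count of vertices and edges, which is easy to follow through a gluing.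
-/
theorem induce_connected_iff [Fintype V] {G : SimpleGraph V} (hG : G.IsTree) {A : Finset V}
    (hA : A.Nonempty) :
    (G.induce (A : Set V)).Connected ↔ intEdges G A + 1 = A.card := by
  have : Nonempty (A : Set V) := hA.to_subtype
  have h := (card_edgeSet_add_one_le_of_isAcyclic (hG.2.induce (A : Set V))).2
  rwa [ncard_edgeSet_induce, Nat.card_coe_set_eq, Set.ncard_coe_finset] at h

@[simp] theorem intEdges_empty (G : SimpleGraph V) : intEdges G ∅ = 0 := by
  have : {e ∈ G.edgeSet | ∀ v ∈ e, v ∈ (∅ : Finset V)} = ∅ := by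
    ext e
    induction e with
    | h x y => simpa using fun _ => ⟨x, fun h => absurd rfl h⟩
  rw [intEdges, this, Set.ncard_empty]

@[simp] theorem extEdges_empty (G : SimpleGraph V) : extEdges G ∅ = 0 := by
  simp [extEdges, ExistsUnique]

@[simp] theorem intEdges_singleton (G : SimpleGraph V) (v : V) : intEdges G {v} = 0 := by
  have : {e ∈ G.edgeSet | ∀ w ∈ e, w ∈ ({v} : Finset V)} = ∅ := by
    ext e
    induction e with
    | h x y =>
      simp only [SimpleGraph.mem_edgeSet, Sym2.mem_iff, Finset.mem_singleton, forall_eq_or_imp,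
        forall_eq, Set.mem_ofPred_eq, Set.mem_empty_iff_false, iff_false, not_and]
      rintro h rfl rfl
      exact h.ne rfl
  rw [intEdges, this, Set.ncard_empty]

theorem extEdges_singleton (G : SimpleGraph V) (v : V) :
    extEdges G {v} = (G.neighborSet v).ncard := by
  have hinj : Set.InjOn (fun w => s(v, w)) (G.neighborSet v) := by
    intro a _ b _ h
    exact Sym2.congr_right.mp h
  rw [extEdges, ← hinj.ncard_image]
  congr 1
  ext e
  constructor
  · rintro ⟨he, w, ⟨hw, hwv⟩, -⟩
    obtain rfl : w = v := by simpa using hwv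
    obtain ⟨x, rfl⟩ := hw
    exact ⟨x, he, rfl⟩
  · rintro ⟨w, hw, rfl⟩
    exact ⟨hw, v, by simp, fun x hx => by simpa using hx.2⟩

theorem isLeaf_iff_extEdges (G : SimpleGraph V) (v : V) : IsLeaf G v ↔ extEdges G {v} = 1 := by
  rw [extEdges_singleton, IsLeaf]

theorem intEdges_univ [Fintype V] (G : SimpleGraph V) : intEdges G Finset.univ = G.edgeSet.ncard := by
  simp [intEdges]

/-! ### Graphs glued from two pieces and an additional edge -/

/-- `G` is the edge-disjoint union of copies of `G₁` and `G₂` that meet in at most one vertex,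
together with one further edge `uv`. -/
structure IsGluing {V₁ V₂ : Type u} (G₁ : SimpleGraph V₁) (G₂ : SimpleGraph V₂)
    (G : SimpleGraph V) (f : V₁ → V) (g : V₂ → V) (u v : V) : Prop where
  injL : Function.Injective f
  injR : Function.Injective g
  ne : u ≠ v
  mem_left : u ∈ Set.range f
  not_mem_left : v ∉ Set.range f
  not_both : ¬ (u ∈ Set.range g ∧ v ∈ Set.range g)
  meet : ∀ x y, x ∈ Set.range f → x ∈ Set.range g → y ∈ Set.range f → y ∈ Set.range g → x = y
  edges : G.edgeSet = Sym2.map f '' G₁.edgeSet ∪ Sym2.map g '' G₂.edgeSet ∪ {s(u, v)}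

namespace IsGluing

variable {V₁ V₂ : Type u} {G₁ : SimpleGraph V₁} {G₂ : SimpleGraph V₂}
  {G : SimpleGraph V} {f : V₁ → V} {g : V₂ → V} {u v : V}

theorem disjoint_left_right (h : IsGluing G₁ G₂ G f g u v) :
    Disjoint (Sym2.map f '' G₁.edgeSet) (Sym2.map g '' G₂.edgeSet) := by
  rw [Set.disjoint_left]
  rintro _ ⟨e, he, rfl⟩ ⟨e', he', hee⟩
  induction e with
  | h a b =>
    induction e' with
    | h c d =>
      have hne : f a ≠ f b := fun hab => G₁.ne_of_adj he (h.injL hab)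
      apply hne
      rw [Sym2.map_mk, Sym2.map_mk, Sym2.eq_iff] at hee
      rcases hee with ⟨h1, h2⟩ | ⟨h1, h2⟩
      · exact h.meet _ _ ⟨a, rfl⟩ ⟨c, h1⟩ ⟨b, rfl⟩ ⟨d, h2⟩
      · exact h.meet _ _ ⟨a, rfl⟩ ⟨d, h2⟩ ⟨b, rfl⟩ ⟨c, h1⟩

theorem edge_notMem (h : IsGluing G₁ G₂ G f g u v) :
    s(u, v) ∉ Sym2.map f '' G₁.edgeSet ∪ Sym2.map g '' G₂.edgeSet := by
  rintro (⟨e, he, hee⟩ | ⟨e, he, hee⟩)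
  · induction e with
    | h a b =>
      rw [Sym2.map_mk, Sym2.eq_iff] at hee
      rcases hee with ⟨h1, h2⟩ | ⟨h1, h2⟩
      · exact h.not_mem_left ⟨b, h2⟩
      · exact h.not_mem_left ⟨a, h1⟩
  · induction e with
    | h a b =>
      rw [Sym2.map_mk, Sym2.eq_iff] at hee
      rcases hee with ⟨h1, h2⟩ | ⟨h1, h2⟩
      · exact h.not_both ⟨⟨a, h1⟩, ⟨b, h2⟩⟩
      · exact h.not_both ⟨⟨b, h2⟩, ⟨a, h1⟩⟩

open Classical in
-- The three families of edges are disjoint, so every count of edges splits; `d` and `e` are the two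
-- instances needed.
theorem ncard_edges [Fintype V] (h : IsGluing G₁ G₂ G f g u v) (P : Sym2 V → Prop) :
    {e ∈ G.edgeSet | P e}.ncard =
      {e ∈ G₁.edgeSet | P (e.map f)}.ncard + {e ∈ G₂.edgeSet | P (e.map g)}.ncard +
        (if P s(u, v) then 1 else 0) := by
  have hset : {e ∈ G.edgeSet | P e} =
      (Sym2.map f '' {e ∈ G₁.edgeSet | P (e.map f)} ∪
        Sym2.map g '' {e ∈ G₂.edgeSet | P (e.map g)}) ∪ {e | e = s(u, v) ∧ P e} := by
    rw [h.edges]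
    ext e
    constructor
    · rintro ⟨(⟨x, hx, rfl⟩ | ⟨x, hx, rfl⟩) | hx, hP⟩
      · exact Or.inl (Or.inl ⟨x, ⟨hx, hP⟩, rfl⟩)
      · exact Or.inl (Or.inr ⟨x, ⟨hx, hP⟩, rfl⟩)
      · exact Or.inr ⟨hx, hP⟩
    · rintro ((⟨x, ⟨hx, hP⟩, rfl⟩ | ⟨x, ⟨hx, hP⟩, rfl⟩) | ⟨hx, hP⟩)
      · exact ⟨Or.inl (Or.inl ⟨x, hx, rfl⟩), hP⟩
      · exact ⟨Or.inl (Or.inr ⟨x, hx, rfl⟩), hP⟩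
      · exact ⟨Or.inr hx, hP⟩
  have hL : Sym2.map f '' {e ∈ G₁.edgeSet | P (e.map f)} ⊆ Sym2.map f '' G₁.edgeSet :=
    Set.image_mono fun _ hx => hx.1
  have hR : Sym2.map g '' {e ∈ G₂.edgeSet | P (e.map g)} ⊆ Sym2.map g '' G₂.edgeSet :=
    Set.image_mono fun _ hx => hx.1
  have hd : {e | e = s(u, v) ∧ P e}.ncard = if P s(u, v) then 1 else 0 := by
    split_ifs with hP
    · rw [Set.ncard_eq_one]
      exact ⟨s(u, v), Set.ext fun e => ⟨fun he => he.1, fun he => ⟨he, he ▸ hP⟩⟩⟩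
    · rw [Set.ncard_eq_zero]
      exact Set.eq_empty_of_forall_notMem fun e he => hP (he.1 ▸ he.2)
  rw [hset, Set.ncard_union_eq _ (Set.toFinite _) (Set.toFinite _),
    Set.ncard_union_eq _ (Set.toFinite _) (Set.toFinite _),
    Set.ncard_image_of_injective _ (Sym2.map.injective h.injL),
    Set.ncard_image_of_injective _ (Sym2.map.injective h.injR), hd]
  · exact h.disjoint_left_right.mono hL hR
  · rw [Set.disjoint_right]
    rintro e ⟨rfl, -⟩ he
    exact h.edge_notMem (Set.union_subset_union hL hR he)

open Classical in
theorem intEdges_eq [Fintype V] (h : IsGluing G₁ G₂ G f g u v) {A : Finset V} {A₁ : Finset V₁}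
    {A₂ : Finset V₂} (h₁ : ∀ a, f a ∈ A ↔ a ∈ A₁) (h₂ : ∀ b, g b ∈ A ↔ b ∈ A₂) :
    intEdges G A = intEdges G₁ A₁ + intEdges G₂ A₂ + (if u ∈ A ∧ v ∈ A then 1 else 0) := by
  simp only [intEdges, h.ncard_edges, Sym2.mem_map, forall_exists_index, and_imp,
    forall_apply_eq_imp_iff₂, h₁, h₂, Sym2.mem_iff, forall_eq_or_imp, forall_eq]

theorem existsUnique_mem_map {W W' : Type*} {φ : W → W'} (hφ : Function.Injective φ)
    (e : Sym2 W) (p : W' → Prop) :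
    (∃! x, x ∈ e.map φ ∧ p x) ↔ ∃! x, x ∈ e ∧ p (φ x) := by
  constructor
  · rintro ⟨x, ⟨hx, hp⟩, hu⟩
    obtain ⟨a, ha, rfl⟩ := Sym2.mem_map.mp hx
    exact ⟨a, ⟨ha, hp⟩, fun b hb => hφ (hu _ ⟨Sym2.mem_map.mpr ⟨b, hb.1, rfl⟩, hb.2⟩)⟩
  · rintro ⟨a, ⟨ha, hp⟩, hu⟩
    refine ⟨φ a, ⟨Sym2.mem_map.mpr ⟨a, ha, rfl⟩, hp⟩, ?_⟩
    rintro _ ⟨hx, hp'⟩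
    obtain ⟨b, hb, rfl⟩ := Sym2.mem_map.mp hx
    rw [hu b ⟨hb, hp'⟩]

theorem existsUnique_mem_mk {W : Type*} {x y : W} (hxy : x ≠ y) (p : W → Prop) :
    (∃! w, w ∈ s(x, y) ∧ p w) ↔ ¬ (p x ↔ p y) := by
  simp only [Sym2.mem_iff, ExistsUnique]
  by_cases hx : p x <;> by_cases hy : p y <;> grind

open Classical in
theorem extEdges_eq [Fintype V] (h : IsGluing G₁ G₂ G f g u v) {A : Finset V} {A₁ : Finset V₁}
    {A₂ : Finset V₂} (h₁ : ∀ a, f a ∈ A ↔ a ∈ A₁) (h₂ : ∀ b, g b ∈ A ↔ b ∈ A₂) :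
    extEdges G A = extEdges G₁ A₁ + extEdges G₂ A₂ + (if u ∈ A ↔ v ∈ A then 0 else 1) := by
  simp only [extEdges, h.ncard_edges, existsUnique_mem_map h.injL, existsUnique_mem_map h.injR,
    existsUnique_mem_mk h.ne, h₁, h₂, ite_not]

theorem reachable_left (h : IsGluing G₁ G₂ G f g u v) (h₁ : G₁.Connected) (a b : V₁) :
    G.Reachable (f a) (f b) := by
  refine (h₁ a b).map ⟨f, fun {x y} hxy => ?_⟩
  rw [← SimpleGraph.mem_edgeSet, h.edges]
  exact Or.inl (Or.inl ⟨s(x, y), hxy, rfl⟩)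

theorem reachable_right (h : IsGluing G₁ G₂ G f g u v) (h₂ : G₂.Connected) (a b : V₂) :
    G.Reachable (g a) (g b) := by
  refine (h₂ a b).map ⟨g, fun {x y} hxy => ?_⟩
  rw [← SimpleGraph.mem_edgeSet, h.edges]
  exact Or.inl (Or.inr ⟨s(x, y), hxy, rfl⟩)

theorem connected (h : IsGluing G₁ G₂ G f g u v) (h₁ : G₁.Connected) (h₂ : G₂.Connected)
    (hcov : ∀ x, x ∈ Set.range f ∨ x ∈ Set.range g ∨ x = v)
    (huv : u ∈ Set.range g ∨ v ∈ Set.range g) : G.Connected := by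
  have hadj : G.Reachable u v := by
    refine SimpleGraph.Adj.reachable ?_
    rw [← SimpleGraph.mem_edgeSet, h.edges]
    exact Or.inr rfl
  have key : ∀ x, G.Reachable u x := by
    intro x
    rcases hcov x with ⟨a, rfl⟩ | ⟨b, rfl⟩ | rfl
    · obtain ⟨c, rfl⟩ := h.mem_left
      exact h.reachable_left h₁ c a
    · rcases huv with ⟨c, rfl⟩ | ⟨c, rfl⟩
      · exact h.reachable_right h₂ c b
      · exact hadj.trans (h.reachable_right h₂ c b)
    · exact hadj
  have : Nonempty V := ⟨u⟩
  exact ⟨fun x y => (key x).symm.trans (key y)⟩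

/-- The edges number `(|V₁| - 1) + (|V₂| - 1) + 1`. The vertex count in `hcard` also fits the
near-concatenation, where the new leaf makes up for the identified vertex. -/
theorem isTree [Fintype V] [Fintype V₁] [Fintype V₂] (h : IsGluing G₁ G₂ G f g u v)
    (h₁ : G₁.IsTree) (h₂ : G₂.IsTree)
    (hcov : ∀ x, x ∈ Set.range f ∨ x ∈ Set.range g ∨ x = v)
    (huv : u ∈ Set.range g ∨ v ∈ Set.range g)
    (hcard : Fintype.card V = Fintype.card V₁ + Fintype.card V₂) : G.IsTree := by
  rw [SimpleGraph.isTree_iff_connected_and_card]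
  refine ⟨h.connected h₁.1 h₂.1 hcov huv, ?_⟩
  have e₁ := (SimpleGraph.isTree_iff_connected_and_card.mp h₁).2
  have e₂ := (SimpleGraph.isTree_iff_connected_and_card.mp h₂).2
  have e := h.intEdges_eq (A := Finset.univ) (A₁ := Finset.univ) (A₂ := Finset.univ)
    (by simp) (by simp)
  rw [intEdges_univ, intEdges_univ, intEdges_univ] at e
  simp only [Finset.mem_univ, and_self, if_true] at e
  rw [Nat.card_coe_set_eq, Nat.card_eq_fintype_card] at e₁ e₂ ⊢
  omega

end IsGluing

/-- The disjoint union of two graphs together with an edge from `r` to `l`. -/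
def joinGraph {V₁ V₂ : Type u} (G₁ : SimpleGraph V₁) (G₂ : SimpleGraph V₂) (r : V₁) (l : V₂) :
    SimpleGraph (V₁ ⊕ V₂) :=
  (G₁ ⊕g G₂) ⊔ SimpleGraph.edge (Sum.inl r) (Sum.inr l)

/-- The disjoint union of two graphs with `r` and `l` identified and a new leaf attached there. -/
def nearGraph {V₁ V₂ : Type u} (G₁ : SimpleGraph V₁) (G₂ : SimpleGraph V₂) (r : V₁) (l : V₂) :
    SimpleGraph (V₁ ⊕ V₂) :=
  nearContraction (joinGraph G₁ G₂ r l) (Sum.inl r) (Sum.inr l)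

open Classical in
/-- The map that sends the second piece into `nearGraph`. -/
noncomputable def nearInr {V₁ V₂ : Type u} (r : V₁) (l : V₂) (x : V₂) : V₁ ⊕ V₂ :=
  if x = l then Sum.inl r else Sum.inr x

section

variable {V₁ V₂ : Type u} (G₁ : SimpleGraph V₁) (G₂ : SimpleGraph V₂) (r : V₁) (l : V₂)

theorem nearInr_self : nearInr r l l = Sum.inl r := by simp [nearInr]

theorem nearInr_of_ne {x : V₂} (h : x ≠ l) : nearInr r l x = Sum.inr x := by simp [nearInr, h]

theorem nearInr_eq_inl {x : V₂} {y : V₁} : nearInr r l x = Sum.inl y ↔ x = l ∧ y = r := by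
  unfold nearInr; grind

theorem nearInr_eq_inr {x y : V₂} : nearInr r l x = Sum.inr y ↔ x = y ∧ y ≠ l := by
  unfold nearInr; grind

theorem joinGraph_isGluing :
    IsGluing G₁ G₂ (joinGraph G₁ G₂ r l) Sum.inl Sum.inr (Sum.inl r) (Sum.inr l) where
  injL := Sum.inl_injective
  injR := Sum.inr_injective
  ne := Sum.inl_ne_inr
  mem_left := ⟨_, rfl⟩
  not_mem_left := by simp
  not_both := by simp
  meet := by
    rintro _ _ ⟨a, rfl⟩ ⟨b, hb⟩
    simp at hb
  edges := by
    ext e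
    induction e with
    | h x y =>
      have := G₁.adj_comm
      have := G₂.adj_comm
      rw [SimpleGraph.mem_edgeSet]
      simp only [joinGraph, SimpleGraph.sup_adj, SimpleGraph.edge_adj, Set.mem_union,
        Set.mem_image, Set.mem_singleton_iff, Sym2.exists, SimpleGraph.mem_edgeSet, Sym2.map_mk,
        Sym2.eq_iff]
      rcases x with x | x <;> rcases y with y | y <;>
        simp only [SimpleGraph.sum_adj, Sum.inl.injEq, Sum.inr.injEq, reduceCtorEq] <;>
        grind

theorem joinGraph_adj (x y : V₁ ⊕ V₂) : (joinGraph G₁ G₂ r l).Adj x y ↔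
    (∃ a b, G₁.Adj a b ∧ x = Sum.inl a ∧ y = Sum.inl b) ∨
    (∃ a b, G₂.Adj a b ∧ x = Sum.inr a ∧ y = Sum.inr b) ∨
    (x = Sum.inl r ∧ y = Sum.inr l) ∨ (x = Sum.inr l ∧ y = Sum.inl r) := by
  simp only [joinGraph, SimpleGraph.sup_adj, SimpleGraph.edge_adj]
  rcases x with x | x <;> rcases y with y | y <;> simp

theorem nearGraph_adj (x y : V₁ ⊕ V₂) : (nearGraph G₁ G₂ r l).Adj x y ↔
    (∃ a b, G₁.Adj a b ∧ x = Sum.inl a ∧ y = Sum.inl b) ∨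
    (∃ a b, G₂.Adj a b ∧ x = nearInr r l a ∧ y = nearInr r l b) ∨
    (x = Sum.inl r ∧ y = Sum.inr l) ∨ (x = Sum.inr l ∧ y = Sum.inl r) := by
  have h1 := G₁.adj_comm
  have h2 := G₂.adj_comm
  have h3 : ∀ a, ¬ G₁.Adj a a := fun _ => G₁.irrefl
  have h4 : ∀ a, ¬ G₂.Adj a a := fun _ => G₂.irrefl
  simp only [nearGraph, nearContraction, SimpleGraph.fromEdgeSet_adj, Set.mem_union, Set.mem_sdiff,
    SimpleGraph.mem_edgeSet, Set.mem_ofPred_eq, Sym2.eq_iff, joinGraph_adj]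
  rcases x with x | x <;> rcases y with y | y <;>
    simp only [Sum.inl.injEq, Sum.inr.injEq, reduceCtorEq, eq_comm (a := Sum.inl _) (b := nearInr _ _ _),
      eq_comm (a := Sum.inr _) (b := nearInr _ _ _), nearInr_eq_inl, nearInr_eq_inr, Sum.exists]
  · grind
  · simp
    grind
  · simp
    grind
  · grind

/-- Here the pieces share the vertex `Sum.inl r`, and the additional edge leads to the new leaf
`Sum.inr l`, which lies in neither piece. For `joinGraph` the pieces are disjoint and the additional
edge connects them. -/
theorem nearGraph_isGluing :
    IsGluing G₁ G₂ (nearGraph G₁ G₂ r l) Sum.inl (nearInr r l) (Sum.inl r) (Sum.inr l) where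
  injL := Sum.inl_injective
  injR := by
    intro a b h
    simp only [nearInr] at h
    grind
  ne := Sum.inl_ne_inr
  mem_left := ⟨_, rfl⟩
  not_mem_left := by simp
  not_both := by
    rintro ⟨-, a, ha⟩
    simp only [nearInr] at ha
    grind
  meet := by
    rintro _ _ ⟨a, rfl⟩ ⟨b, hb⟩ ⟨c, rfl⟩ ⟨d, hd⟩
    simp only [nearInr] at hb hd
    grind
  edges := by
    ext e
    induction e with
    | h x y =>
      have := G₁.adj_comm
      have := G₂.adj_comm
      rw [SimpleGraph.mem_edgeSet, nearGraph_adj]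
      simp only [Set.mem_union,
        Set.mem_image, Set.mem_singleton_iff, Sym2.exists, SimpleGraph.mem_edgeSet, Sym2.map_mk,
        Sym2.eq_iff]
      grind

variable {G₁ G₂} [Fintype V₁] [Fintype V₂]

theorem joinGraph_isTree (h₁ : G₁.IsTree) (h₂ : G₂.IsTree) : (joinGraph G₁ G₂ r l).IsTree := by
  refine (joinGraph_isGluing G₁ G₂ r l).isTree h₁ h₂ ?_ (Or.inr ⟨_, rfl⟩) Fintype.card_sum
  rintro (x | x) <;> simp

theorem nearGraph_isTree (h₁ : G₁.IsTree) (h₂ : G₂.IsTree) : (nearGraph G₁ G₂ r l).IsTree := by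
  refine (nearGraph_isGluing G₁ G₂ r l).isTree h₁ h₂ ?_ (Or.inl ⟨l, nearInr_self r l⟩)
    Fintype.card_sum
  rintro (x | x)
  · exact Or.inl ⟨x, rfl⟩
  · by_cases hx : x = l
    · exact Or.inr (Or.inr (by rw [hx]))
    · exact Or.inr (Or.inl ⟨x, nearInr_of_ne r l hx⟩)

end

end TreeHDP

/-! ### Subtree sums weighted at the two ends. -/

namespace TreeHDP

open Classical in
/-- The weight of a vertex set of a tree: `y ^ d(A) * z ^ e(A)` if `A` is nonempty and connected,
and zero otherwise. -/
noncomputable def subtreeWeight {V : Type u} (G : SimpleGraph V) (A : Finset V) :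
    MvPolynomial (Fin 2) ℤ :=
  if A.Nonempty ∧ intEdges G A + 1 = A.card then subtreeMonomial G A else 0

open Classical in
/-- The sum of the weights of the subtrees, with additional factors `p` and `q` for those that
contain `L` and `R`, respectively. -/
noncomputable def endSum {V : Type u} [Fintype V] (G : SimpleGraph V) (L R : V)
    (p q : MvPolynomial (Fin 2) ℤ) : MvPolynomial (Fin 2) ℤ :=
  ∑ A : Finset V, subtreeWeight G A * (if L ∈ A then p else 1) * (if R ∈ A then q else 1)

theorem hdp_eq_endSum {V : Type u} [Fintype V] {G : SimpleGraph V} (hG : G.IsTree) (L R : V) :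
    hdp G = endSum G L R 1 1 := by
  classical
  simp only [hdp, endSum, ite_self, mul_one, Finset.sum_filter, subtreeWeight]
  refine Finset.sum_congr rfl fun A _ => ?_
  by_cases hA : A.Nonempty
  · simp [hA, induce_connected_iff hG hA]
  · simp [hA]

section

variable {V : Type u} [Fintype V] (G : SimpleGraph V) (L R : V) (p q : MvPolynomial (Fin 2) ℤ)

open Classical in
theorem endSum_zero_right :
    endSum G L R p 0 = ∑ A : Finset V, if R ∈ A then 0 else
      subtreeWeight G A * (if L ∈ A then p else 1) := by
  refine Finset.sum_congr rfl fun A _ => ?_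
  by_cases hR : R ∈ A <;> simp [hR]

open Classical in
theorem endSum_zero_left :
    endSum G L R 0 q = ∑ A : Finset V, if L ∈ A then 0 else
      subtreeWeight G A * (if R ∈ A then q else 1) := by
  refine Finset.sum_congr rfl fun A _ => ?_
  by_cases hL : L ∈ A <;> simp [hL]

open Classical in
theorem endSum_sub_right :
    endSum G L R p 1 - endSum G L R p 0 = ∑ A : Finset V, if R ∈ A then
      subtreeWeight G A * (if L ∈ A then p else 1) else 0 := by
  rw [endSum, endSum, ← Finset.sum_sub_distrib]
  refine Finset.sum_congr rfl fun A _ => ?_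
  by_cases hR : R ∈ A <;> simp [hR]

open Classical in
theorem endSum_sub_left :
    endSum G L R 1 q - endSum G L R 0 q = ∑ A : Finset V, if L ∈ A then
      subtreeWeight G A * (if R ∈ A then q else 1) else 0 := by
  rw [endSum, endSum, ← Finset.sum_sub_distrib]
  refine Finset.sum_congr rfl fun A _ => ?_
  by_cases hL : L ∈ A <;> simp [hL]

/-- The coefficient of `q` is the sum over the subtrees through `R`; differences of this kind select
such subtrees below. -/
theorem endSum_affine_right :
    endSum G L R p q = endSum G L R p 0 + q * (endSum G L R p 1 - endSum G L R p 0) := by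
  classical
  rw [endSum_sub_right, endSum_zero_right, endSum, Finset.mul_sum, ← Finset.sum_add_distrib]
  refine Finset.sum_congr rfl fun A _ => ?_
  by_cases hR : R ∈ A <;> simp [hR, mul_comm]

theorem endSum_affine_left :
    endSum G L R p q = endSum G L R 0 q + p * (endSum G L R 1 q - endSum G L R 0 q) := by
  classical
  rw [endSum_sub_left, endSum_zero_left, endSum, Finset.mul_sum, ← Finset.sum_add_distrib]
  refine Finset.sum_congr rfl fun A _ => ?_
  by_cases hL : L ∈ A
  · simp [hL, mul_comm, mul_left_comm]
  · simp [hL]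

end

@[simp] theorem subtreeWeight_empty {V : Type u} (G : SimpleGraph V) :
    subtreeWeight G ∅ = 0 := by
  simp [subtreeWeight]

section

variable {V₁ V₂ : Type u} [Fintype V₁] [Fintype V₂] {G₁ : SimpleGraph V₁} {G₂ : SimpleGraph V₂}
  (L₁ r : V₁) (l R₂ : V₂) (p q : MvPolynomial (Fin 2) ℤ)

theorem sum_finset_sum {M : Type*} [AddCommMonoid M] (F : Finset (V₁ ⊕ V₂) → M) :
    ∑ A, F A = ∑ A₁ : Finset V₁, ∑ A₂ : Finset V₂, F (A₁.disjSum A₂) := by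
  rw [← Fintype.sum_prod_type']
  exact (Fintype.sum_equiv Finset.sumEquiv.symm.toEquiv _ _ fun _ => rfl).symm

open Classical in
-- Pairs each set avoiding `l` with its enlargement by `l`. In `nearGraph` this isolates the choice
-- whether the new leaf is taken.
theorem sum_finset_insert {V M : Type*} [Fintype V] [AddCommMonoid M] (l : V)
    (F : Finset V → M) : ∑ B, F B = ∑ B, if l ∈ B then 0 else F B + F (insert l B) := by
  have h1 : ∀ B : Finset V, (if l ∈ B then 0 else F B + F (insert l B)) =
      (if l ∉ B then F B else 0) + (if l ∉ B then F (insert l B) else 0) := by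
    intro B
    by_cases h : l ∈ B <;> simp [h]
  rw [Finset.sum_congr rfl fun B _ => h1 B, Finset.sum_add_distrib, ← Finset.sum_filter,
    ← Finset.sum_filter, ← Finset.sum_filter_not_add_sum_filter Finset.univ (fun B => l ∈ B) F]
  congr 1
  refine Finset.sum_bij' (fun B _ => B.erase l) (fun B _ => insert l B) ?_ ?_ ?_ ?_ ?_
  · simp
  · simp
  · intro B hB
    exact Finset.insert_erase (by simpa using hB)
  · intro B hB
    exact Finset.erase_insert (by simpa using hB)
  · intro B hB
    rw [Finset.insert_erase (by simpa using hB)]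

open Classical in
-- A connected set either lies in one piece, where the new edge costs `y` if it touches the set, or
-- uses the new edge, at the price `z`, and meets both pieces in connected sets.
theorem subtreeWeight_joinGraph (h₁ : G₁.IsTree) (h₂ : G₂.IsTree) (A₁ : Finset V₁)
    (A₂ : Finset V₂) : subtreeWeight (joinGraph G₁ G₂ r l) (A₁.disjSum A₂) =
      (if A₂ = ∅ then subtreeWeight G₁ A₁ * (if r ∈ A₁ then MvPolynomial.X 0 else 1) else 0) +
      (if A₁ = ∅ then subtreeWeight G₂ A₂ * (if l ∈ A₂ then MvPolynomial.X 0 else 1) else 0) +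
      (if r ∈ A₁ then subtreeWeight G₁ A₁ else 0) *
        (if l ∈ A₂ then MvPolynomial.X 1 * subtreeWeight G₂ A₂ else 0) := by
  have hg := joinGraph_isGluing G₁ G₂ r l
  have hi := hg.intEdges_eq (A := A₁.disjSum A₂) (A₁ := A₁) (A₂ := A₂) (by simp) (by simp)
  have he := hg.extEdges_eq (A := A₁.disjSum A₂) (A₁ := A₁) (A₂ := A₂) (by simp) (by simp)
  simp only [Finset.inl_mem_disjSum, Finset.inr_mem_disjSum] at hi he
  simp only [subtreeWeight, subtreeMonomial, hi, he, Finset.card_disjSum]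
  rcases A₁.eq_empty_or_nonempty with rfl | hA₁
  · rcases A₂.eq_empty_or_nonempty with rfl | hA₂
    · simp
    · by_cases hl : l ∈ A₂ <;> simp [hl, hA₂, hA₂.ne_empty, pow_succ, mul_right_comm]
  · have b₁ := intEdges_add_one_le h₁ hA₁
    rcases A₂.eq_empty_or_nonempty with rfl | hA₂
    · by_cases hr : r ∈ A₁ <;> simp [hr, hA₁, hA₁.ne_empty, pow_succ, mul_right_comm]
    · have b₂ := intEdges_add_one_le h₂ hA₂
      have hd : (A₁.disjSum A₂).Nonempty := by
        rw [← Finset.card_pos, Finset.card_disjSum]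
        omega
      by_cases hrl : r ∈ A₁ ∧ l ∈ A₂
      -- Each piece satisfies `e + 1 ≤ |A|`, so the total is tight only if both bounds are.
      · have hiff : intEdges G₁ A₁ + intEdges G₂ A₂ + 1 + 1 = A₁.card + A₂.card ↔
            intEdges G₁ A₁ + 1 = A₁.card ∧ intEdges G₂ A₂ + 1 = A₂.card := by omega
        by_cases c₁ : intEdges G₁ A₁ + 1 = A₁.card <;>
          by_cases c₂ : intEdges G₂ A₂ + 1 = A₂.card <;>
          simp [hrl.1, hrl.2, hA₁, hA₂, hA₁.ne_empty, hA₂.ne_empty, hiff, c₁, c₂, hd]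
        ring
      · have hne : ¬ intEdges G₁ A₁ + intEdges G₂ A₂ + 1 = A₁.card + A₂.card := by omega
        rw [not_and_or] at hrl
        rcases hrl with h | h <;> simp [h, hA₁.ne_empty, hA₂.ne_empty, hne]

theorem endSum_joinGraph (h₁ : G₁.IsTree) (h₂ : G₂.IsTree) :
    endSum (joinGraph G₁ G₂ r l) (Sum.inl L₁) (Sum.inr R₂) p q =
      endSum G₁ L₁ r p (MvPolynomial.X 0) + endSum G₂ l R₂ (MvPolynomial.X 0) q +
      MvPolynomial.X 1 * (endSum G₁ L₁ r p 1 - endSum G₁ L₁ r p 0) *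
        (endSum G₂ l R₂ 1 q - endSum G₂ l R₂ 0 q) := by
  classical
  have hterm : ∀ (A₁ : Finset V₁) (A₂ : Finset V₂),
      subtreeWeight (joinGraph G₁ G₂ r l) (A₁.disjSum A₂) *
        (if Sum.inl L₁ ∈ A₁.disjSum A₂ then p else 1) *
        (if Sum.inr R₂ ∈ A₁.disjSum A₂ then q else 1) =
      (if A₂ = ∅ then subtreeWeight G₁ A₁ * (if L₁ ∈ A₁ then p else 1) *
        (if r ∈ A₁ then MvPolynomial.X 0 else 1) else 0) +
      (if A₁ = ∅ then subtreeWeight G₂ A₂ * (if l ∈ A₂ then MvPolynomial.X 0 else 1) *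
        (if R₂ ∈ A₂ then q else 1) else 0) +
      MvPolynomial.X 1 * ((if r ∈ A₁ then subtreeWeight G₁ A₁ * (if L₁ ∈ A₁ then p else 1) else 0) *
        (if l ∈ A₂ then subtreeWeight G₂ A₂ * (if R₂ ∈ A₂ then q else 1) else 0)) := by
    intro A₁ A₂
    rw [subtreeWeight_joinGraph r l h₁ h₂]
    simp only [Finset.inl_mem_disjSum, Finset.inr_mem_disjSum]
    by_cases e₁ : A₁ = ∅
    · subst e₁
      by_cases e₂ : A₂ = ∅
      · subst e₂
        simp
      · simp [e₂]
    · by_cases e₂ : A₂ = ∅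
      · subst e₂
        simp only [e₁, if_true, if_false, Finset.notMem_empty, mul_zero, add_zero]
        rw [mul_one, mul_right_comm]
      · simp only [e₁, e₂, if_false, zero_add]
        split_ifs <;> ring
  rw [endSum, sum_finset_sum]
  refine (Finset.sum_congr rfl fun A₁ _ => Finset.sum_congr rfl fun A₂ _ =>
    Eq.trans (by congr!) (hterm A₁ A₂)).trans ?_
  simp only [Finset.sum_add_distrib, ← Finset.mul_sum, ← Finset.sum_mul]
  rw [endSum_sub_right, endSum_sub_left, endSum, endSum, mul_assoc]
  congr 1
  congr 1
  · simp
  · rw [Finset.sum_comm]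
    simp

open Classical in
-- Without the merged vertex, the two pieces and the new leaf are separated from each other, so a
-- connected set lies in just one of them.
theorem subtreeWeight_nearGraph_of_notMem (h₁ : G₁.IsTree) (h₂ : G₂.IsTree) {A₁ : Finset V₁}
    {B : Finset V₂} (hr : r ∉ A₁) (hl : l ∉ B) :
    subtreeWeight (nearGraph G₁ G₂ r l) (A₁.disjSum B) =
      (if B = ∅ then subtreeWeight G₁ A₁ else 0) + (if A₁ = ∅ then subtreeWeight G₂ B else 0) ∧
    subtreeWeight (nearGraph G₁ G₂ r l) (A₁.disjSum (insert l B)) =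
      (if A₁ = ∅ ∧ B = ∅ then MvPolynomial.X 0 else 0) := by
  have hg := nearGraph_isGluing G₁ G₂ r l
  have hB : ∀ b, nearInr r l b ∈ A₁.disjSum B ↔ b ∈ B := by
    intro b
    unfold nearInr
    split_ifs with h <;> simp [h, hr, hl]
  -- `Sum.inr l` is the new leaf, not the image of `l`, so taking it does not change the trace on
  -- the second piece.
  have hB' : ∀ b, nearInr r l b ∈ A₁.disjSum (insert l B) ↔ b ∈ B := by
    intro b
    unfold nearInr
    split_ifs with h <;> simp [h, hr, hl]
  have hi := hg.intEdges_eq (A := A₁.disjSum B) (A₁ := A₁) (A₂ := B) (by simp) hB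
  have he := hg.extEdges_eq (A := A₁.disjSum B) (A₁ := A₁) (A₂ := B) (by simp) hB
  have hi' := hg.intEdges_eq (A := A₁.disjSum (insert l B)) (A₁ := A₁) (A₂ := B) (by simp) hB'
  have he' := hg.extEdges_eq (A := A₁.disjSum (insert l B)) (A₁ := A₁) (A₂ := B) (by simp) hB'
  simp only [Finset.inl_mem_disjSum, Finset.inr_mem_disjSum, hr, hl, Finset.mem_insert_self,
    false_and, if_false, iff_true, iff_self, if_true, add_zero] at hi he hi' he'
  simp only [subtreeWeight, subtreeMonomial, hi, he, hi', he', Finset.card_disjSum,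
    Finset.card_insert_of_notMem hl]
  rcases A₁.eq_empty_or_nonempty with rfl | hA₁
  · rcases B.eq_empty_or_nonempty with rfl | hB
    · simp
    · have b₂ := intEdges_add_one_le h₂ hB
      have hne : ¬ intEdges G₂ B = B.card := by omega
      simp [hB, hB.ne_empty, hne]
  · have b₁ := intEdges_add_one_le h₁ hA₁
    rcases B.eq_empty_or_nonempty with rfl | hB
    · have hne : ¬ intEdges G₁ A₁ = A₁.card := by omega
      simp [hA₁, hA₁.ne_empty, hne]
    · have b₂ := intEdges_add_one_le h₂ hB
      have n1 : ¬ intEdges G₁ A₁ + intEdges G₂ B + 1 = A₁.card + B.card := by omega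
      have n2 : ¬ intEdges G₁ A₁ + intEdges G₂ B + 1 = A₁.card + (B.card + 1) := by omega
      simp [hB.ne_empty, hA₁.ne_empty, n1, n2]

open Classical in
-- The merged vertex belongs to both traces, whence `insert l B`. The pendant edge gives `y` if the
-- leaf is left out and `z` if it is taken.
theorem subtreeWeight_nearGraph_of_mem (h₁ : G₁.IsTree) (h₂ : G₂.IsTree) {A₁ : Finset V₁}
    {B : Finset V₂} (hr : r ∈ A₁) (hl : l ∉ B) :
    subtreeWeight (nearGraph G₁ G₂ r l) (A₁.disjSum B) =
      MvPolynomial.X 0 * (subtreeWeight G₁ A₁ * subtreeWeight G₂ (insert l B)) ∧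
    subtreeWeight (nearGraph G₁ G₂ r l) (A₁.disjSum (insert l B)) =
      MvPolynomial.X 1 * (subtreeWeight G₁ A₁ * subtreeWeight G₂ (insert l B)) := by
  have hg := nearGraph_isGluing G₁ G₂ r l
  have hB : ∀ b, nearInr r l b ∈ A₁.disjSum B ↔ b ∈ insert l B := by
    intro b
    unfold nearInr
    split_ifs with h <;> simp [h, hr]
  have hB' : ∀ b, nearInr r l b ∈ A₁.disjSum (insert l B) ↔ b ∈ insert l B := by
    intro b
    unfold nearInr
    split_ifs with h <;> simp [h, hr]
  have hi := hg.intEdges_eq (A := A₁.disjSum B) (A₁ := A₁) (A₂ := insert l B) (by simp) hB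
  have he := hg.extEdges_eq (A := A₁.disjSum B) (A₁ := A₁) (A₂ := insert l B) (by simp) hB
  have hi' := hg.intEdges_eq (A := A₁.disjSum (insert l B)) (A₁ := A₁) (A₂ := insert l B)
    (by simp) hB'
  have he' := hg.extEdges_eq (A := A₁.disjSum (insert l B)) (A₁ := A₁) (A₂ := insert l B)
    (by simp) hB'
  simp only [Finset.inl_mem_disjSum, Finset.inr_mem_disjSum, hr, hl, Finset.mem_insert_self,
    and_false, and_self, if_false, iff_false, not_true, iff_self, if_true, add_zero]
    at hi he hi' he'
  have hA₁ : A₁.Nonempty := ⟨r, hr⟩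
  have hlB : (insert l B).Nonempty := ⟨l, Finset.mem_insert_self l B⟩
  have b₁ := intEdges_add_one_le h₁ hA₁
  have b₂ := intEdges_add_one_le h₂ hlB
  rw [Finset.card_insert_of_notMem hl] at b₂
  simp only [subtreeWeight, subtreeMonomial, hi, he, hi', he', Finset.card_disjSum,
    Finset.card_insert_of_notMem hl]
  have i1 : intEdges G₁ A₁ + intEdges G₂ (insert l B) + 1 = A₁.card + B.card ↔
      intEdges G₁ A₁ + 1 = A₁.card ∧ intEdges G₂ (insert l B) + 1 = B.card + 1 := by omega
  have i2 : intEdges G₁ A₁ + intEdges G₂ (insert l B) + 1 + 1 = A₁.card + (B.card + 1) ↔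
      intEdges G₁ A₁ + 1 = A₁.card ∧ intEdges G₂ (insert l B) + 1 = B.card + 1 := by omega
  have hd : (A₁.disjSum B).Nonempty := ⟨Sum.inl r, by simpa using hr⟩
  have hd' : (A₁.disjSum (insert l B)).Nonempty := ⟨Sum.inl r, by simpa using hr⟩
  simp only [i1, i2]
  by_cases c₁ : intEdges G₁ A₁ + 1 = A₁.card
  · by_cases c₂ : intEdges G₂ (insert l B) + 1 = B.card + 1
    · simp only [c₁, c₂, hA₁, hlB, hd, hd', and_self, if_true]
      constructor <;> ring
    · simp only [c₂, and_false, if_false, mul_zero, and_self]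
  · simp only [c₁, false_and, and_false, if_false, mul_zero, zero_mul, and_self]

open Classical in
-- Subtrees avoiding the merged vertex lie in one piece or are the new leaf alone (`y`). The others
-- are pairs of subtrees through `r` and through `l`, with `y + z` for the free choice of the leaf.
theorem endSum_nearGraph (h₁ : G₁.IsTree) (h₂ : G₂.IsTree) :
    endSum (nearGraph G₁ G₂ r l) (Sum.inl L₁) (if R₂ = l then Sum.inl r else Sum.inr R₂) p q =
      endSum G₁ L₁ r p 0 + endSum G₂ l R₂ 0 q + MvPolynomial.X 0 +
      (MvPolynomial.X 0 + MvPolynomial.X 1) * (endSum G₁ L₁ r p 1 - endSum G₁ L₁ r p 0) *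
        (endSum G₂ l R₂ 1 q - endSum G₂ l R₂ 0 q) := by
  have hterm : ∀ (A₁ : Finset V₁) (B : Finset V₂),
      (if l ∈ B then 0 else
        subtreeWeight (nearGraph G₁ G₂ r l) (A₁.disjSum B) *
          (if Sum.inl L₁ ∈ A₁.disjSum B then p else 1) *
          (if (if R₂ = l then Sum.inl r else Sum.inr R₂) ∈ A₁.disjSum B then q else 1) +
        subtreeWeight (nearGraph G₁ G₂ r l) (A₁.disjSum (insert l B)) *
          (if Sum.inl L₁ ∈ A₁.disjSum (insert l B) then p else 1) *
          (if (if R₂ = l then Sum.inl r else Sum.inr R₂) ∈ A₁.disjSum (insert l B) then q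
            else 1)) =
      (if B = ∅ then if r ∈ A₁ then 0 else subtreeWeight G₁ A₁ * (if L₁ ∈ A₁ then p else 1)
        else 0) +
      (if A₁ = ∅ then if l ∈ B then 0 else subtreeWeight G₂ B * (if R₂ ∈ B then q else 1)
        else 0) +
      (if A₁ = ∅ then if B = ∅ then MvPolynomial.X 0 else 0 else 0) +
      (MvPolynomial.X 0 + MvPolynomial.X 1) *
        ((if r ∈ A₁ then subtreeWeight G₁ A₁ * (if L₁ ∈ A₁ then p else 1) else 0) *
        (if l ∈ B then 0 else
          subtreeWeight G₂ (insert l B) * (if R₂ ∈ insert l B then q else 1))) := by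
    intro A₁ B
    by_cases hl : l ∈ B
    · have hB : B ≠ ∅ := Finset.ne_empty_of_mem hl
      simp [hl, hB]
    have hR : ∀ C : Finset V₂, (if R₂ = l then Sum.inl r else Sum.inr R₂) ∈ A₁.disjSum C ↔
        if R₂ = l then r ∈ A₁ else R₂ ∈ C := by
      intro C
      split_ifs <;> simp
    simp only [hl, if_false, hR, Finset.inl_mem_disjSum]
    by_cases hr : r ∈ A₁
    · have hA : A₁ ≠ ∅ := Finset.ne_empty_of_mem hr
      obtain ⟨w1, w2⟩ := subtreeWeight_nearGraph_of_mem r l h₁ h₂ hr hl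
      rw [w1, w2]
      by_cases hRl : R₂ = l
      · simp only [hRl, hr, hA, if_true, if_false, Finset.mem_insert_self, ite_self]
        ring
      · simp only [hRl, hr, hA, if_true, if_false, Finset.mem_insert, false_or, ite_self]
        ring
    · obtain ⟨w1, w2⟩ := subtreeWeight_nearGraph_of_notMem r l h₁ h₂ hr hl
      rw [w1, w2]
      have hRB : (if R₂ = l then r ∈ A₁ else R₂ ∈ B) ↔ R₂ ∈ B := by
        split_ifs with h <;> simp [h, hr, hl]
      rw [if_congr hRB rfl rfl]
      by_cases e₁ : A₁ = ∅
      · subst e₁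
        by_cases e₂ : B = ∅
        · subst e₂
          simp
        · simp [e₂]
      · by_cases e₂ : B = ∅
        · subst e₂
          simp [e₁, hr]
        · simp [e₁, e₂, hr]
  have hins : ∑ B : Finset V₂, (if l ∈ B then 0 else
        subtreeWeight G₂ (insert l B) * (if R₂ ∈ insert l B then q else 1)) =
      endSum G₂ l R₂ 1 q - endSum G₂ l R₂ 0 q := by
    symm
    rw [endSum_sub_left, sum_finset_insert l]
    refine Finset.sum_congr rfl fun B _ => ?_
    by_cases hl : l ∈ B <;> simp [hl]
  rw [endSum, sum_finset_sum]
  rw [Finset.sum_congr rfl fun A₁ _ => sum_finset_insert l _]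
  refine (Finset.sum_congr rfl fun A₁ _ => Finset.sum_congr rfl fun B _ =>
    Eq.trans (by congr!) (hterm A₁ B)).trans ?_
  simp only [Finset.sum_add_distrib, ← Finset.mul_sum, ← Finset.sum_mul]
  rw [hins, endSum_sub_right, endSum_zero_right, endSum_zero_left, mul_assoc]
  congr 1
  congr 1
  · congr 1
    · simp
    · rw [Finset.sum_comm]
      simp
  · simp

end

end TreeHDP

/-! ### Leaves under gluing, and the difference between the two polynomials. -/

namespace TreeHDP

theorem extEdges_singleton_pos {V : Type u} [Fintype V] {G : SimpleGraph V} (hG : G.Connected)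
    {v w : V} (h : v ≠ w) : 0 < extEdges G {v} := by
  have : Nontrivial V := ⟨v, w, h⟩
  obtain ⟨x, hx⟩ := hG.preconnected.exists_adj_of_nontrivial v
  rw [extEdges_singleton, Set.ncard_pos]
  exact ⟨x, hx⟩

open Classical in
/-- The number of leaves other than `L` and `R`. -/
noncomputable def innerLeaves {V : Type u} [Fintype V] (G : SimpleGraph V) (L R : V) : ℕ :=
  (Finset.univ.filter fun v => v ≠ L ∧ v ≠ R ∧ extEdges G {v} = 1).card

section

variable {V₁ V₂ : Type u} [Fintype V₁] [Fintype V₂] {G₁ : SimpleGraph V₁} {G₂ : SimpleGraph V₂}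
  (L₁ r : V₁) (l R₂ : V₂)

open Classical in
theorem extEdges_joinGraph_inl (a : V₁) :
    extEdges (joinGraph G₁ G₂ r l) {Sum.inl a} =
      extEdges G₁ {a} + (if a = r then 1 else 0) := by
  rw [(joinGraph_isGluing G₁ G₂ r l).extEdges_eq (A₁ := {a}) (A₂ := ∅) (by simp) (by simp)]
  by_cases h : a = r
  · simp [h]
  · simp [h, Ne.symm h]

open Classical in
theorem extEdges_joinGraph_inr (b : V₂) :
    extEdges (joinGraph G₁ G₂ r l) {Sum.inr b} =
      extEdges G₂ {b} + (if b = l then 1 else 0) := by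
  rw [(joinGraph_isGluing G₁ G₂ r l).extEdges_eq (A₁ := ∅) (A₂ := {b}) (by simp) (by simp)]
  by_cases h : b = l
  · simp [h]
  · simp [h, Ne.symm h]

open Classical in
theorem extEdges_nearGraph_inl (a : V₁) :
    extEdges (nearGraph G₁ G₂ r l) {Sum.inl a} =
      extEdges G₁ {a} + (if a = r then extEdges G₂ {l} + 1 else 0) := by
  by_cases h : a = r
  · subst h
    rw [(nearGraph_isGluing G₁ G₂ a l).extEdges_eq (A₁ := {a}) (A₂ := {l}) (by simp)
      (by simp [nearInr_eq_inl])]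
    simp
    ring
  · rw [(nearGraph_isGluing G₁ G₂ r l).extEdges_eq (A₁ := {a}) (A₂ := ∅) (by simp)
      (by simp [nearInr_eq_inl, h])]
    simp [h, Ne.symm h]

open Classical in
theorem extEdges_nearGraph_inr (b : V₂) :
    extEdges (nearGraph G₁ G₂ r l) {Sum.inr b} =
      if b = l then 1 else extEdges G₂ {b} := by
  by_cases h : b = l
  · subst h
    rw [(nearGraph_isGluing G₁ G₂ r b).extEdges_eq (A₁ := ∅) (A₂ := ∅) (by simp)
      (by simp [nearInr_eq_inr])]
    simp
  · rw [(nearGraph_isGluing G₁ G₂ r l).extEdges_eq (A₁ := ∅) (A₂ := {b}) (by simp)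
      (by simp [nearInr_eq_inr, h])]
    simp [h, Ne.symm h]

/-- A joining vertex that is not an end of the result has an old edge and a new one, so it is no
leaf. Not counting the ends makes the number additive. -/
theorem innerLeaves_joinGraph (h₁ : G₁.Connected) (h₂ : G₂.Connected) :
    innerLeaves (joinGraph G₁ G₂ r l) (Sum.inl L₁) (Sum.inr R₂) =
      innerLeaves G₁ L₁ r + innerLeaves G₂ l R₂ := by
  classical
  simp only [innerLeaves, Finset.card_filter, Fintype.sum_sum_type, extEdges_joinGraph_inl,
    extEdges_joinGraph_inr]
  congr 1
  · refine Finset.sum_congr rfl fun a _ => if_congr ?_ rfl rfl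
    by_cases har : a = r
    · subst har
      by_cases ha : a = L₁
      · simp [ha]
      · have := extEdges_singleton_pos h₁ ha
        simp [this.ne']
    · simp [har]
  · refine Finset.sum_congr rfl fun b _ => if_congr ?_ rfl rfl
    by_cases hbl : b = l
    · subst hbl
      by_cases hb : b = R₂
      · simp [hb]
      · have := extEdges_singleton_pos h₂ hb
        simp [this.ne']
    · simp [hbl]

open Classical in
theorem innerLeaves_nearGraph (h₁ : G₁.Connected) :
    innerLeaves (nearGraph G₁ G₂ r l) (Sum.inl L₁)
        (if R₂ = l then Sum.inl r else Sum.inr R₂) =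
      innerLeaves G₁ L₁ r + innerLeaves G₂ l R₂ + 1 := by
  -- The summand at `b = l` accounts for the new leaf `Sum.inr l`, which is never an end.
  have h1 : (1 : ℕ) = ∑ b : V₂, if b = l then 1 else 0 := by simp
  simp only [innerLeaves, Finset.card_filter, Fintype.sum_sum_type, extEdges_nearGraph_inl,
    extEdges_nearGraph_inr]
  rw [add_assoc]
  congr 1
  rotate_left
  · conv_rhs => rw [h1, ← Finset.sum_add_distrib]
    refine Finset.sum_congr rfl fun b _ => ?_
    by_cases hbl : b = l
    · subst hbl
      by_cases hb : R₂ = b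
      · simp [hb]
      · simp [hb, Ne.symm hb]
    · by_cases hR : R₂ = l
      · simp [hbl, hR]
      · simp [hbl, hR]
  · refine Finset.sum_congr rfl fun a _ => if_congr ?_ rfl rfl
    by_cases har : a = r
    · subst har
      by_cases ha : a = L₁
      · simp [ha]
      · have := extEdges_singleton_pos h₁ ha
        have h2 : extEdges G₁ {a} + (extEdges G₂ {l} + 1) ≠ 1 := by omega
        simp [h2]
    · by_cases hR : R₂ = l <;> simp [har, hR]

end

theorem subtreeMonomial_singleton_of_isLeaf {V : Type u} {G : SimpleGraph V} {v : V}
    (hv : IsLeaf G v) : subtreeMonomial G {v} = MvPolynomial.X 0 := by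
  rw [subtreeMonomial, (isLeaf_iff_extEdges G v).mp hv, intEdges_singleton, pow_one, pow_zero,
    mul_one]

/-- Two adjacent leaves have no other neighbours, so they would form a whole component, while `w`
must be reachable from them. -/
theorem eq_singleton_of_forall_isLeaf {V : Type u} {G : SimpleGraph V} (hG : G.Connected)
    {w : V} (hw : ¬ IsLeaf G w) {A : Finset V} {v : V} (hv : v ∈ A)
    (hA : (G.induce (A : Set V)).Connected) (hleaf : ∀ x ∈ A, IsLeaf G x) : A = {v} := by
  by_contra hne
  have hex : ∃ x ∈ A, x ≠ v := by
    by_contra! hcon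
    exact hne (Finset.eq_singleton_iff_unique_mem.mpr ⟨hv, hcon⟩)
  obtain ⟨x, hx, hxv⟩ := hex
  have : Nontrivial (A : Set V) := ⟨⟨v, hv⟩, ⟨x, hx⟩, fun h => hxv (Subtype.ext_iff.mp h).symm⟩
  obtain ⟨⟨b, hb⟩, hvb⟩ := hA.preconnected.exists_adj_of_nontrivial ⟨v, hv⟩
  have hvb' : G.Adj v b := hvb
  have huniq : ∀ a ∈ A, ∀ c d, G.Adj a c → G.Adj a d → c = d := by
    intro a ha c d hc hd
    obtain ⟨e, he⟩ := Set.ncard_eq_one.mp (hleaf a ha)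
    have h1 : c ∈ G.neighborSet a := hc
    have h2 : d ∈ G.neighborSet a := hd
    rw [he] at h1 h2
    exact h1.trans h2.symm
  have hwA : w ∉ ({v, b} : Set V) := by
    rintro (rfl | rfl)
    · exact hw (hleaf _ hv)
    · exact hw (hleaf _ hb)
  obtain ⟨p⟩ := hG v w
  obtain ⟨d, -, hd1, hd2⟩ := p.exists_boundary_dart {v, b} (Or.inl rfl) hwA
  apply hd2
  have hadj := d.adj
  rcases hd1 with h | h
  · rw [h] at hadj
    exact Or.inr (huniq v hv _ _ hadj hvb')
  · rw [Set.mem_singleton_iff.mp h] at hadj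
    exact Or.inl (huniq b hb _ _ hadj hvb'.symm)

open Classical in
theorem hdp_eq_modifiedHdp_add {V : Type u} [Fintype V] {G : SimpleGraph V} (hG : G.Connected)
    {w : V} (hw : ¬ IsLeaf G w) :
    hdp G = modifiedHdp G + (Finset.univ.filter fun v => IsLeaf G v).card • MvPolynomial.X 0 := by
  rw [hdp, modifiedHdp, ← Finset.sum_filter_add_sum_filter_not _ (fun A => ∃ v ∈ A, ¬ IsLeaf G v),
    Finset.filter_filter, Finset.filter_filter]
  congr 1
  rw [← Finset.sum_const]
  symm
  refine Finset.sum_bij (fun v _ => {v}) ?_ ?_ ?_ ?_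
  · intro v hv
    have hv' := (Finset.mem_filter.mp hv).2
    refine Finset.mem_filter.mpr ⟨Finset.mem_univ _,
      ⟨Finset.singleton_nonempty v, ?_⟩, by simpa using hv'⟩
    rw [Finset.coe_singleton]
    exact SimpleGraph.Connected.of_subsingleton
  · intro a _ b _ h
    exact Finset.singleton_injective h
  · intro A hA
    obtain ⟨⟨⟨v, hv⟩, hc⟩, hl⟩ := (Finset.mem_filter.mp hA).2
    push Not at hl
    refine ⟨v, Finset.mem_filter.mpr ⟨Finset.mem_univ _, hl v hv⟩, ?_⟩
    exact (eq_singleton_of_forall_isLeaf hG hw hv hc hl).symm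
  · intro v hv
    exact (subtreeMonomial_singleton_of_isLeaf (Finset.mem_filter.mp hv).2).symm

/-! ### End sums and leaves of polarized trees, and the effect of framing. -/

namespace PolarizedGraph

/-- The end-weighted sum of subtree weights of a polarized tree. -/
noncomputable def ends (S : PolarizedGraph.{u}) (p q : MvPolynomial (Fin 2) ℤ) :
    MvPolynomial (Fin 2) ℤ :=
  endSum S.graph S.left S.right p q

/-- The number of leaves of a polarized tree that are not ends. -/
noncomputable def leaves (S : PolarizedGraph.{u}) : ℕ :=
  innerLeaves S.graph S.left S.right

theorem one_isTree : one.{u}.graph.IsTree := by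
  have : Subsingleton one.{u}.V := inferInstanceAs (Subsingleton PUnit)
  have : Nonempty one.{u}.V := ⟨one.left⟩
  exact SimpleGraph.IsTree.of_subsingleton

theorem extEdges_one (A : Finset one.{u}.V) : extEdges one.{u}.graph A = 0 := by
  have h : one.{u}.graph.edgeSet = ∅ := SimpleGraph.edgeSet_bot
  simp [extEdges, h]

theorem ends_one (p q : MvPolynomial (Fin 2) ℤ) : one.{u}.ends p q = p * q := by
  classical
  have hu : (Finset.univ : Finset (Finset one.{u}.V)) = {∅, {one.left}} := by
    ext A
    simp only [Finset.mem_univ, Finset.mem_insert, Finset.mem_singleton, true_iff]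
    rcases A.eq_empty_or_nonempty with h | ⟨x, hx⟩
    · exact Or.inl h
    · exact Or.inr (Finset.eq_singleton_iff_unique_mem.mpr ⟨hx, fun _ _ => rfl⟩)
  have hr : one.{u}.right = one.left := rfl
  rw [ends, endSum, hu, Finset.sum_pair (Finset.singleton_ne_empty _).symm]
  simp [subtreeWeight, subtreeMonomial, extEdges_one, hr]

theorem leaves_one : one.{u}.leaves = 0 := by
  simp [leaves, innerLeaves, extEdges_one]

variable {S T U : PolarizedGraph.{u}}

theorem concat_isTree (hS : S.graph.IsTree) (hT : T.graph.IsTree) :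
    (S.concat T).graph.IsTree :=
  joinGraph_isTree S.right T.left hS hT

theorem nearConcat_isTree (hS : S.graph.IsTree) (hT : T.graph.IsTree) :
    (S.nearConcat T).graph.IsTree :=
  nearGraph_isTree S.right T.left hS hT

theorem ends_concat (hS : S.graph.IsTree) (hT : T.graph.IsTree) (p q : MvPolynomial (Fin 2) ℤ) :
    (S.concat T).ends p q = S.ends p (MvPolynomial.X 0) + T.ends (MvPolynomial.X 0) q +
      MvPolynomial.X 1 * (S.ends p 1 - S.ends p 0) * (T.ends 1 q - T.ends 0 q) :=
  endSum_joinGraph S.left S.right T.left T.right p q hS hT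

theorem ends_nearConcat (hS : S.graph.IsTree) (hT : T.graph.IsTree)
    (p q : MvPolynomial (Fin 2) ℤ) :
    (S.nearConcat T).ends p q = S.ends p 0 + T.ends 0 q + MvPolynomial.X 0 +
      (MvPolynomial.X 0 + MvPolynomial.X 1) * (S.ends p 1 - S.ends p 0) *
        (T.ends 1 q - T.ends 0 q) :=
  endSum_nearGraph S.left S.right T.left T.right p q hS hT

theorem leaves_concat (hS : S.graph.IsTree) (hT : T.graph.IsTree) :
    (S.concat T).leaves = S.leaves + T.leaves :=
  innerLeaves_joinGraph S.left S.right T.left T.right hS.1 hT.1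

theorem leaves_nearConcat (hS : S.graph.IsTree) :
    (S.nearConcat T).leaves = S.leaves + T.leaves + 1 :=
  innerLeaves_nearGraph S.left S.right T.left T.right hS.1

theorem framed_isTree (hS : S.graph.IsTree) : S.framed.graph.IsTree :=
  nearConcat_isTree (nearConcat_isTree one_isTree hS) one_isTree

/-- Since `one.ends p q = p * q`, near-concatenation with `1` multiplies the weight of the end
concerned by `y + z` and adds `y` for the new leaf alone. -/
theorem hdp_framed (hS : S.graph.IsTree) :
    hdp S.framed.graph = S.ends (MvPolynomial.X 0 + MvPolynomial.X 1)
      (MvPolynomial.X 0 + MvPolynomial.X 1) + 2 * MvPolynomial.X 0 := by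
  have h1 := nearConcat_isTree one_isTree hS
  rw [hdp_eq_endSum (framed_isTree hS) S.framed.left S.framed.right]
  change S.framed.ends 1 1 = _
  rw [framed, ends_nearConcat h1 one_isTree]
  simp only [ends_nearConcat one_isTree hS, ends_one]
  generalize (MvPolynomial.X 0 + MvPolynomial.X 1 : MvPolynomial (Fin 2) ℤ) = s
  have e1 : S.ends s s = S.ends s 0 + s * (S.ends s 1 - S.ends s 0) := endSum_affine_right ..
  have e2 : S.ends s 0 = S.ends 0 0 + s * (S.ends 1 0 - S.ends 0 0) := endSum_affine_left ..
  have e3 : S.ends s 1 = S.ends 0 1 + s * (S.ends 1 1 - S.ends 0 1) := endSum_affine_left ..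
  rw [e1, e2, e3]
  ring

theorem leaves_framed (hS : S.graph.IsTree) : S.framed.leaves = S.leaves + 2 := by
  rw [framed, leaves_nearConcat (nearConcat_isTree one_isTree hS), leaves_nearConcat one_isTree,
    leaves_one]
  ring

theorem one_nearConcat_extEdges_left :
    extEdges (one.nearConcat S).graph {(one.nearConcat S).left} = extEdges S.graph {S.left} + 1 := by
  classical
  refine (extEdges_nearGraph_inl (G₁ := one.graph) (G₂ := S.graph) one.right S.left one.left).trans ?_
  rw [extEdges_one, if_pos (show one.left = one.right from rfl), zero_add]

open Classical in
theorem nearConcat_one_extEdges (a : S.V) :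
    extEdges (S.nearConcat one).graph {Sum.inl a} =
      extEdges S.graph {a} + if a = S.right then 1 else 0 := by
  refine (extEdges_nearGraph_inl (G₁ := S.graph) (G₂ := one.graph) S.right one.left a).trans ?_
  rw [extEdges_one]

theorem one_nearConcat_extEdges_pos (hS : S.graph.IsTree) (a : (one.nearConcat S).V) :
    0 < extEdges (one.nearConcat S).graph {a} := by
  have hc := (nearConcat_isTree one_isTree hS).1
  rcases a with a | a
  · exact extEdges_singleton_pos (w := Sum.inr S.left) hc Sum.inl_ne_inr
  · exact extEdges_singleton_pos (w := Sum.inl one.left) hc Sum.inr_ne_inl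

theorem framed_right_not_isLeaf (hS : S.graph.IsTree) :
    ¬ IsLeaf S.framed.graph S.framed.right := by
  classical
  have hr : S.framed.right = Sum.inl (one.nearConcat S).right := if_pos rfl
  have h := one_nearConcat_extEdges_pos hS (one.nearConcat S).right
  rw [isLeaf_iff_extEdges, hr]
  have e := nearConcat_one_extEdges (S := one.nearConcat S) (one.nearConcat S).right
  rw [if_pos rfl] at e
  intro hcon
  have := e.symm.trans hcon
  omega

theorem framed_left_not_isLeaf (hS : S.graph.IsTree) :
    ¬ IsLeaf S.framed.graph S.framed.left := by
  classical
  have e := nearConcat_one_extEdges (S := one.nearConcat S) (one.nearConcat S).left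
  rw [one_nearConcat_extEdges_left] at e
  rw [isLeaf_iff_extEdges]
  intro hcon
  have h := e.symm.trans hcon
  -- If the ends coincide, the left end receives both framing leaves; otherwise it already has an
  -- edge in `S`.
  by_cases hlr : S.right = S.left
  · have hr : (one.nearConcat S).right = Sum.inl one.right := if_pos hlr
    have hl : (one.nearConcat S).left = (one.nearConcat S).right := hr.symm
    rw [if_pos hl] at h
    omega
  · have := extEdges_singleton_pos hS.1 (Ne.symm hlr)
    omega

theorem hdp_framed_eq_modifiedHdp (hS : S.graph.IsTree) :
    hdp S.framed.graph = modifiedHdp S.framed.graph + (S.leaves + 2) • MvPolynomial.X 0 := by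
  classical
  rw [hdp_eq_modifiedHdp_add (framed_isTree hS).1 (framed_left_not_isLeaf hS), ← leaves_framed hS,
    leaves, innerLeaves]
  congr 3
  refine Finset.filter_congr fun v _ => ?_
  rw [isLeaf_iff_extEdges]
  refine ⟨fun h => ⟨?_, ?_, h⟩, fun h => h.2.2⟩
  · rintro rfl
    exact framed_left_not_isLeaf hS ((isLeaf_iff_extEdges _ _).mpr h)
  · rintro rfl
    exact framed_right_not_isLeaf hS ((isLeaf_iff_extEdges _ _).mpr h)

theorem modifiedHdp_framed (hS : S.graph.IsTree) :
    modifiedHdp S.framed.graph = S.ends (MvPolynomial.X 0 + MvPolynomial.X 1)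
      (MvPolynomial.X 0 + MvPolynomial.X 1) - S.leaves • MvPolynomial.X 0 := by
  have h1 := hdp_framed hS
  rw [hdp_framed_eq_modifiedHdp hS] at h1
  rw [eq_sub_of_add_eq h1, add_smul]
  simp only [nsmul_eq_mul]
  push_cast
  ring

/-- The end sums alone satisfy this up to the term `y z` caused by the leaf that `⊙` creates; the
correction for that leaf cancels it. -/
theorem modifiedHdp_framed_concat (hS : S.graph.IsTree) (hT : T.graph.IsTree) :
    (MvPolynomial.X 0 + MvPolynomial.X 1) * modifiedHdp (S.concat T).framed.graph =
      MvPolynomial.X 0 * (modifiedHdp S.framed.graph + modifiedHdp T.framed.graph) +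
        MvPolynomial.X 1 * modifiedHdp (S.nearConcat T).framed.graph := by
  rw [modifiedHdp_framed (concat_isTree hS hT), modifiedHdp_framed hS, modifiedHdp_framed hT,
    modifiedHdp_framed (nearConcat_isTree hS hT), ends_concat hS hT, ends_nearConcat hS hT,
    leaves_concat hS hT, leaves_nearConcat hS]
  have e1 : ∀ p q, S.ends p q = S.ends p 0 + q * (S.ends p 1 - S.ends p 0) :=
    fun p q => endSum_affine_right _ _ _ p q
  have e2 : ∀ p q, T.ends p q = T.ends 0 q + p * (T.ends 1 q - T.ends 0 q) :=
    fun p q => endSum_affine_left _ _ _ p q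
  generalize hs : (MvPolynomial.X 0 + MvPolynomial.X 1 : MvPolynomial (Fin 2) ℤ) = s
  rw [e1 s (MvPolynomial.X 0), e1 s s, e2 (MvPolynomial.X 0) s, e2 s s]
  simp only [nsmul_eq_mul, Nat.cast_add, Nat.cast_one, ← hs]
  ring

end PolarizedGraph
end TreeHDP

/-! ### Associativity at the level of end sums, and the recursion for `α ∘ T`. -/

namespace TreeHDP
namespace PolarizedGraph

variable {S S' T T' U : PolarizedGraph.{u}}

/-- Two polarized graphs agree in the numbers of their inner leaves and in their end-weighted
subtree sums. -/
def SameEnds (S S' : PolarizedGraph.{u}) : Prop :=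
  (∀ p q, S.ends p q = S'.ends p q) ∧ S.leaves = S'.leaves

theorem SameEnds.trans {S S' S'' : PolarizedGraph.{u}} (h : SameEnds S S') (h' : SameEnds S' S'') :
    SameEnds S S'' :=
  ⟨fun p q => (h.1 p q).trans (h'.1 p q), h.2.trans h'.2⟩

theorem SameEnds.nearConcat (hS : S.graph.IsTree) (hS' : S'.graph.IsTree) (hT : T.graph.IsTree)
    (h : SameEnds S S') : SameEnds (S.nearConcat T) (S'.nearConcat T) :=
  ⟨fun p q => by simp only [ends_nearConcat hS hT, ends_nearConcat hS' hT, h.1],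
    by rw [leaves_nearConcat hS, leaves_nearConcat hS', h.2]⟩

theorem SameEnds.concat (hS : S.graph.IsTree) (hS' : S'.graph.IsTree) (hT : T.graph.IsTree)
    (h : SameEnds S S') : SameEnds (S.concat T) (S'.concat T) :=
  ⟨fun p q => by simp only [ends_concat hS hT, ends_concat hS' hT, h.1],
    by rw [leaves_concat hS hT, leaves_concat hS' hT, h.2]⟩

/-- The two bracketings live on different vertex types. Comparing end sums and leaf numbers
suffices, as they determine the modified HDP after framing. -/
theorem nearConcat_assoc_sameEnds (hS : S.graph.IsTree) (hT : T.graph.IsTree)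
    (hU : U.graph.IsTree) :
    SameEnds (S.nearConcat (T.nearConcat U)) ((S.nearConcat T).nearConcat U) := by
  have hTU := nearConcat_isTree hT hU
  have hST := nearConcat_isTree hS hT
  constructor
  · intro p q
    simp only [ends_nearConcat hS hTU, ends_nearConcat hST hU, ends_nearConcat hS hT,
      ends_nearConcat hT hU]
    ring
  · rw [leaves_nearConcat hS, leaves_nearConcat hST, leaves_nearConcat hS, leaves_nearConcat hT]
    ring

theorem nearConcat_concat_sameEnds (hS : S.graph.IsTree) (hT : T.graph.IsTree)
    (hU : U.graph.IsTree) :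
    SameEnds (S.nearConcat (T.concat U)) ((S.nearConcat T).concat U) := by
  have hTU := concat_isTree hT hU
  have hST := nearConcat_isTree hS hT
  constructor
  · intro p q
    simp only [ends_nearConcat hS hTU, ends_concat hST hU, ends_nearConcat hS hT,
      ends_concat hT hU]
    ring
  · rw [leaves_nearConcat hS, leaves_concat hST hU, leaves_nearConcat hS, leaves_concat hT hU]
    ring

theorem nearPow_one (T : PolarizedGraph.{u}) : T.nearPow 1 = T :=
  PNat.recOn_one _ _

theorem nearPow_succ (T : PolarizedGraph.{u}) (n : ℕ+) :
    T.nearPow (n + 1) = (T.nearPow n).nearConcat T :=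
  PNat.recOn_succ _ _ _

theorem nearPow_isTree (hT : T.graph.IsTree) (n : ℕ+) : (T.nearPow n).graph.IsTree := by
  induction n using PNat.recOn with
  | one => rwa [nearPow_one]
  | succ n ih =>
    rw [nearPow_succ]
    exact nearConcat_isTree ih hT

theorem compose_isTree (hT : T.graph.IsTree) (α : List ℕ+) : (T.compose α).graph.IsTree := by
  induction α with
  | nil => exact one_isTree
  | cons a l ih =>
    cases l with
    | nil => exact nearPow_isTree hT a
    | cons b l => exact concat_isTree (nearPow_isTree hT a) ih

theorem nearPow_add_sameEnds (hT : T.graph.IsTree) (a b : ℕ+) :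
    SameEnds ((T.nearPow a).nearConcat (T.nearPow b)) (T.nearPow (a + b)) := by
  induction b using PNat.recOn with
  | one =>
    rw [nearPow_one, nearPow_succ]
    exact ⟨fun _ _ => rfl, rfl⟩
  | succ b ih =>
    have ha := nearPow_isTree hT a
    have hb := nearPow_isTree hT b
    rw [← add_assoc, nearPow_succ, nearPow_succ]
    exact (nearConcat_assoc_sameEnds ha hb hT).trans
      (ih.nearConcat (nearConcat_isTree ha hb) (nearPow_isTree hT _) hT)

theorem nearPow_nearConcat_compose_sameEnds (hT : T.graph.IsTree) (a b : ℕ+) (l : List ℕ+) :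
    SameEnds ((T.nearPow a).nearConcat (T.compose (b :: l))) (T.compose ((a + b) :: l)) := by
  cases l with
  | nil => exact nearPow_add_sameEnds hT a b
  | cons c l =>
    have ha := nearPow_isTree hT a
    have hb := nearPow_isTree hT b
    have hl := compose_isTree hT (c :: l)
    exact (nearConcat_concat_sameEnds ha hb hl).trans
      ((nearPow_add_sameEnds hT a b).concat (nearConcat_isTree ha hb) (nearPow_isTree hT _) hl)

theorem SameEnds.modifiedHdp_framed_eq (hS : S.graph.IsTree) (hS' : S'.graph.IsTree)
    (h : SameEnds S S') : modifiedHdp S.framed.graph = modifiedHdp S'.framed.graph := by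
  rw [modifiedHdp_framed hS, modifiedHdp_framed hS', h.1, h.2]

theorem modifiedHdp_framed_compose (hT : T.graph.IsTree) (a b : ℕ+) (l : List ℕ+) :
    (MvPolynomial.X 0 + MvPolynomial.X 1) * modifiedHdp (T.compose (a :: b :: l)).framed.graph =
      MvPolynomial.X 0 * (modifiedHdp (T.compose [a]).framed.graph +
        modifiedHdp (T.compose (b :: l)).framed.graph) +
      MvPolynomial.X 1 * modifiedHdp (T.compose ((a + b) :: l)).framed.graph := by
  have ha := nearPow_isTree hT a
  have hl := compose_isTree hT (b :: l)
  rw [← (nearPow_nearConcat_compose_sameEnds hT a b l).modifiedHdp_framed_eq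
    (nearConcat_isTree ha hl) (compose_isTree hT _)]
  exact modifiedHdp_framed_concat ha hl

theorem leaves_nearPow (hT : T.graph.IsTree) (n : ℕ+) :
    (T.nearPow n).leaves + 1 = n * (T.leaves + 1) := by
  induction n using PNat.recOn with
  | one => rw [nearPow_one]; simp
  | succ n ih =>
    rw [nearPow_succ, leaves_nearConcat (nearPow_isTree hT n), PNat.add_coe, PNat.one_coe, add_mul,
      ← ih]
    ring

/-- `⊙` creates a leaf and `·` does not, so inner leaves plus one is additive under `⊙`, and each
part of `α` lowers the total by one. -/
theorem leaves_compose (hT : T.graph.IsTree) {α : List ℕ+} (hα : α ≠ []) :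
    (T.compose α).leaves + α.length = size α * (T.leaves + 1) := by
  induction α with
  | nil => exact absurd rfl hα
  | cons a l ih =>
    have h1 := leaves_nearPow hT a
    cases l with
    | nil => simpa [size, compose] using h1
    | cons b l =>
      have hs : size (a :: b :: l) = a + size (b :: l) := rfl
      have h2 := ih (List.cons_ne_nil _ _)
      have h3 := leaves_concat (nearPow_isTree hT a) (compose_isTree hT (b :: l))
      rw [hs, add_mul, ← h1, ← h2]
      change ((T.nearPow a).concat (T.compose (b :: l))).leaves + _ = _
      rw [h3, List.length_cons (a := a)]
      ring

/-- By `leaves_compose` the natural subtraction is not truncated. -/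
theorem hdp_framed_compose (hT : T.graph.IsTree) {α : List ℕ+} (hα : α ≠ []) :
    hdp (T.compose α).framed.graph = modifiedHdp (T.compose α).framed.graph +
      (size α * (T.leaves + 1) - α.length + 2) • MvPolynomial.X 0 := by
  rw [hdp_framed_eq_modifiedHdp (compose_isTree hT α), ← leaves_compose hT hα,
    Nat.add_sub_cancel]

end PolarizedGraph
end TreeHDP

namespace TreeHDP

/-! ### Near-concatenation, composition and reversal of compositions -/

theorem exists_eq_concat {α : List ℕ+} (h : α ≠ []) : ∃ l a, α = l ++ [a] :=
  ⟨_, _, (List.dropLast_append_getLast h).symm⟩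

/-- The normal form for computations: split off the last part on the left and the first part on the
right. -/
theorem nearConcat_concat_cons (l : List ℕ+) (a b : ℕ+) (m : List ℕ+) :
    nearConcat (l ++ [a]) (b :: m) = l ++ (a + b) :: m := by
  induction l with
  | nil => rfl
  | cons c l ih =>
    cases l with
    | nil => rfl
    | cons d l => exact congrArg (c :: ·) ih

theorem nearConcat_ne_nil {α β : List ℕ+} (hα : α ≠ []) (hβ : β ≠ []) : nearConcat α β ≠ [] := by
  obtain ⟨l, a, rfl⟩ := exists_eq_concat hα
  obtain ⟨b, m, rfl⟩ := List.exists_cons_of_ne_nil hβ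
  simp [nearConcat_concat_cons]

theorem nearConcat_append {α β : List ℕ+} (hα : α ≠ []) (hβ : β ≠ []) (γ : List ℕ+) :
    nearConcat α (β ++ γ) = nearConcat α β ++ γ := by
  obtain ⟨l, a, rfl⟩ := exists_eq_concat hα
  obtain ⟨b, m, rfl⟩ := List.exists_cons_of_ne_nil hβ
  simp [nearConcat_concat_cons]

theorem append_nearConcat {β γ : List ℕ+} (α : List ℕ+) (hβ : β ≠ []) (hγ : γ ≠ []) :
    nearConcat (α ++ β) γ = α ++ nearConcat β γ := by
  obtain ⟨l, a, rfl⟩ := exists_eq_concat hβ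
  obtain ⟨b, m, rfl⟩ := List.exists_cons_of_ne_nil hγ
  rw [← List.append_assoc, nearConcat_concat_cons, nearConcat_concat_cons, List.append_assoc]

theorem nearConcat_assoc {α β γ : List ℕ+} (hα : α ≠ []) (hβ : β ≠ []) (hγ : γ ≠ []) :
    nearConcat α (nearConcat β γ) = nearConcat (nearConcat α β) γ := by
  obtain ⟨l, a, rfl⟩ := exists_eq_concat hα
  obtain ⟨c, n, rfl⟩ := List.exists_cons_of_ne_nil hγ
  obtain ⟨b, m, rfl⟩ := List.exists_cons_of_ne_nil hβ
  cases m with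
  | nil =>
    rw [nearConcat_concat_cons l a b []]
    have h := nearConcat_concat_cons [] b c n
    simp only [List.nil_append] at h
    rw [h, nearConcat_concat_cons, nearConcat_concat_cons, add_assoc]
  | cons d m =>
    change nearConcat (l ++ [a]) ([b] ++ nearConcat (d :: m) (c :: n)) = _
    rw [nearConcat_concat_cons l a b (d :: m)]
    have h : l ++ (a + b) :: d :: m = (l ++ [a + b]) ++ (d :: m) := by simp
    rw [h, append_nearConcat _ (List.cons_ne_nil _ _) (List.cons_ne_nil _ _)]
    simp [nearConcat_concat_cons]

theorem nearConcat_reverse {α β : List ℕ+} (hα : α ≠ []) (hβ : β ≠ []) :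
    (nearConcat α β).reverse = nearConcat β.reverse α.reverse := by
  obtain ⟨l, a, rfl⟩ := exists_eq_concat hα
  obtain ⟨b, m, rfl⟩ := List.exists_cons_of_ne_nil hβ
  have h : (l ++ [a]).reverse = a :: l.reverse := by simp
  rw [nearConcat_concat_cons, List.reverse_cons, h, nearConcat_concat_cons, add_comm]
  simp

theorem nearPow_one (β : List ℕ+) : nearPow β 1 = β :=
  PNat.recOn_one _ _

theorem nearPow_succ (β : List ℕ+) (n : ℕ+) : nearPow β (n + 1) = nearConcat (nearPow β n) β :=
  PNat.recOn_succ _ _ _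

theorem nearPow_ne_nil {β : List ℕ+} (hβ : β ≠ []) (n : ℕ+) : nearPow β n ≠ [] := by
  induction n using PNat.recOn with
  | one => rwa [nearPow_one]
  | succ n ih =>
    rw [nearPow_succ]
    exact nearConcat_ne_nil ih hβ

theorem nearPow_add {β : List ℕ+} (hβ : β ≠ []) (a b : ℕ+) :
    nearConcat (nearPow β a) (nearPow β b) = nearPow β (a + b) := by
  induction b using PNat.recOn with
  | one => rw [nearPow_one, nearPow_succ]
  | succ b ih =>
    rw [nearPow_succ, nearConcat_assoc (nearPow_ne_nil hβ a) (nearPow_ne_nil hβ b) hβ, ih,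
      ← add_assoc, nearPow_succ]

theorem nearPow_reverse {β : List ℕ+} (hβ : β ≠ []) (n : ℕ+) :
    (nearPow β n).reverse = nearPow β.reverse n := by
  have hβ' : β.reverse ≠ [] := by simpa using hβ
  induction n using PNat.recOn with
  | one => rw [nearPow_one, nearPow_one]
  | succ n ih =>
    rw [nearPow_succ, nearConcat_reverse (nearPow_ne_nil hβ n) hβ, ih, add_comm n 1,
      ← nearPow_add hβ', nearPow_one]

theorem compose_cons (a : ℕ+) (α β : List ℕ+) :
    compose (a :: α) β = nearPow β a ++ compose α β :=
  List.flatMap_cons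

theorem compose_singleton (a : ℕ+) (β : List ℕ+) : compose [a] β = nearPow β a :=
  List.flatMap_singleton ..

theorem compose_ne_nil {α β : List ℕ+} (hα : α ≠ []) (hβ : β ≠ []) : compose α β ≠ [] := by
  obtain ⟨a, l, rfl⟩ := List.exists_cons_of_ne_nil hα
  rw [compose_cons]
  simp [nearPow_ne_nil hβ a]

theorem compose_reverse {β : List ℕ+} (α : List ℕ+) (hβ : β ≠ []) :
    (compose α β).reverse = compose α.reverse β.reverse := by
  rw [compose, List.reverse_flatMap, compose]
  congr 1
  exact funext fun a => nearPow_reverse hβ a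

theorem nearPow_nearConcat_compose {β : List ℕ+} (hβ : β ≠ []) (a b : ℕ+) (l : List ℕ+) :
    nearConcat (nearPow β a) (compose (b :: l) β) = compose ((a + b) :: l) β := by
  rw [compose_cons, compose_cons, nearConcat_append (nearPow_ne_nil hβ a) (nearPow_ne_nil hβ b),
    nearPow_add hβ]

theorem nearConcat_compose {α β γ : List ℕ+} (hα : α ≠ []) (hβ : β ≠ []) (hγ : γ ≠ []) :
    compose (nearConcat α β) γ = nearConcat (compose α γ) (compose β γ) := by
  obtain ⟨l, a, rfl⟩ := exists_eq_concat hα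
  obtain ⟨b, m, rfl⟩ := List.exists_cons_of_ne_nil hβ
  have h : ∀ l m : List ℕ+, compose (l ++ m) γ = compose l γ ++ compose m γ :=
    fun l m => List.flatMap_append
  rw [nearConcat_concat_cons, h, h, append_nearConcat _ (compose_ne_nil (List.cons_ne_nil _ _) hγ)
    (compose_ne_nil (List.cons_ne_nil _ _) hγ), compose_singleton, nearPow_nearConcat_compose hγ]

theorem nearPow_compose {β γ : List ℕ+} (hβ : β ≠ []) (hγ : γ ≠ []) (n : ℕ+) :
    compose (nearPow β n) γ = nearPow (compose β γ) n := by
  induction n using PNat.recOn with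
  | one => rw [nearPow_one, nearPow_one]
  | succ n ih => rw [nearPow_succ, nearConcat_compose (nearPow_ne_nil hβ n) hβ hγ, ih, nearPow_succ]

theorem compose_assoc {β γ : List ℕ+} (α : List ℕ+) (hβ : β ≠ []) (hγ : γ ≠ []) :
    compose (compose α β) γ = compose α (compose β γ) := by
  rw [compose, compose, List.flatMap_assoc]
  exact congrArg (fun f => α.flatMap f) (funext fun a => nearPow_compose hβ hγ a)

theorem size_append (α β : List ℕ+) : size (α ++ β) = size α + size β := by
  simp [size]

theorem size_cons (a : ℕ+) (α : List ℕ+) : size (a :: α) = a + size α := rfl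

theorem size_reverse (α : List ℕ+) : size α.reverse = size α := by
  simp [size]

theorem size_nearConcat {α β : List ℕ+} (hα : α ≠ []) (hβ : β ≠ []) :
    size (nearConcat α β) = size α + size β ∧
      (nearConcat α β).length + 1 = α.length + β.length := by
  obtain ⟨l, a, rfl⟩ := exists_eq_concat hα
  obtain ⟨b, m, rfl⟩ := List.exists_cons_of_ne_nil hβ
  rw [nearConcat_concat_cons]
  constructor
  · simp only [size_append, size_cons, PNat.add_coe]
    simp only [size, List.map_nil, List.sum_nil]
    ring
  · simp
    ring

theorem size_nearPow {β : List ℕ+} (hβ : β ≠ []) (n : ℕ+) :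
    size (nearPow β n) = n * size β ∧ (nearPow β n).length + n = n * β.length + 1 := by
  induction n using PNat.recOn with
  | one => rw [nearPow_one]; simp
  | succ n ih =>
    obtain ⟨h1, h2⟩ := size_nearConcat (nearPow_ne_nil hβ n) hβ
    rw [nearPow_succ, PNat.add_coe, PNat.one_coe, add_mul, add_mul]
    omega

theorem size_compose {β : List ℕ+} (α : List ℕ+) (hβ : β ≠ []) :
    size (compose α β) = size α * size β ∧
      (compose α β).length + size α = size α * β.length + α.length := by
  induction α with
  | nil => exact ⟨(Nat.zero_mul _).symm, by simp [compose, size]⟩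
  | cons a l ih =>
    obtain ⟨h1, h2⟩ := size_nearPow hβ a
    rw [compose_cons, size_append, List.length_append, size_cons, add_mul, add_mul,
      List.length_cons]
    omega

theorem composeAll_ne_nil {F : List (List ℕ+)} (hF : ∀ φ ∈ F, φ ≠ []) : composeAll F ≠ [] := by
  induction F with
  | nil => simp [composeAll]
  | cons φ F ih =>
    exact compose_ne_nil (hF φ (by simp)) (ih fun ψ hψ => hF ψ (by simp [hψ]))

/-! ### The coarsenings of a composition -/

theorem mem_partialSums_nil {s : ℕ} : s ∈ partialSums [] ↔ s = 0 := by
  simp [partialSums, size]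

theorem mem_partialSums_cons {s : ℕ} {a : ℕ+} {l : List ℕ+} :
    s ∈ partialSums (a :: l) ↔ s = 0 ∨ ∃ t ∈ partialSums l, s = a + t := by
  constructor
  · rintro ⟨j, rfl⟩
    cases j with
    | zero => exact Or.inl rfl
    | succ j => exact Or.inr ⟨_, ⟨j, rfl⟩, rfl⟩
  · rintro (rfl | ⟨_, ⟨j, rfl⟩, rfl⟩)
    · exact ⟨0, rfl⟩
    · exact ⟨j + 1, rfl⟩

theorem zero_mem_partialSums (l : List ℕ+) : 0 ∈ partialSums l := ⟨0, rfl⟩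

/-- The alternative is whether the partial sum `a` survives in `γ`. -/
theorem isCoarsening_cons_cons {a b : ℕ+} {l γ : List ℕ+} :
    IsCoarsening γ (a :: b :: l) ↔
      (∃ γ', IsCoarsening γ' (b :: l) ∧ γ = a :: γ') ∨ IsCoarsening γ ((a + b) :: l) := by
  have ha := a.pos
  have hb := b.pos
  constructor
  · rintro ⟨hs, hp⟩
    cases γ with
    | nil =>
      simp only [size_cons] at hs
      have : size [] = 0 := rfl
      omega
    | cons c γ =>
      have hc := c.pos
      -- The first part `c` of `γ` is a partial sum of `γ`, so it equals `a` or is at least `a + b`.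
      have hmem := hp (mem_partialSums_cons.mpr (Or.inr ⟨0, zero_mem_partialSums γ, rfl⟩))
      rw [mem_partialSums_cons] at hmem
      obtain h0 | ⟨t, ht, hct⟩ := hmem
      · omega
      rw [mem_partialSums_cons] at ht
      simp only [size_cons] at hs
      obtain rfl | ⟨t', -, rfl⟩ := ht
      · have hca : c = a := PNat.eq (by omega)
        subst hca
        refine Or.inl ⟨γ, ⟨by rw [size_cons]; omega, fun u hu => ?_⟩, rfl⟩
        have hu' := hp (mem_partialSums_cons.mpr (Or.inr ⟨u, hu, rfl⟩))
        rw [mem_partialSums_cons] at hu'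
        obtain h0 | ⟨v, hv, hcv⟩ := hu'
        · omega
        · obtain rfl : u = v := by omega
          exact hv
      · refine Or.inr ⟨by simp only [size_cons, PNat.add_coe]; omega, fun s hsm => ?_⟩
        have hs' := hp hsm
        rw [mem_partialSums_cons] at hsm hs' ⊢
        obtain rfl | ⟨u, -, rfl⟩ := hsm
        · exact Or.inl rfl
        · obtain h0 | ⟨v, hv, hcv⟩ := hs'
          · exact Or.inl h0
          · rw [mem_partialSums_cons] at hv
            obtain rfl | ⟨w, hw, rfl⟩ := hv
            · omega
            · exact Or.inr ⟨w, hw, by rw [PNat.add_coe]; omega⟩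
  · rintro (⟨γ', ⟨hs, hp⟩, rfl⟩ | ⟨hs, hp⟩)
    · refine ⟨by rw [size_cons, size_cons, hs], fun s hsm => ?_⟩
      rw [mem_partialSums_cons] at hsm ⊢
      exact hsm.imp_right fun ⟨t, ht, hst⟩ => ⟨t, hp ht, hst⟩
    · refine ⟨by rw [hs]; simp only [size_cons, PNat.add_coe]; omega, fun s hsm => ?_⟩
      have h := hp hsm
      rw [mem_partialSums_cons] at h ⊢
      refine h.imp_right fun ⟨t, ht, hst⟩ => ⟨b + t, mem_partialSums_cons.mpr (Or.inr ⟨t, ht, rfl⟩), ?_⟩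
      rw [hst, PNat.add_coe]
      omega

theorem isCoarsening_singleton {a : ℕ+} {γ : List ℕ+} : IsCoarsening γ [a] ↔ γ = [a] := by
  have ha := a.pos
  have h0 : size [] = 0 := rfl
  constructor
  · rintro ⟨hs, hp⟩
    cases γ with
    | nil =>
      simp only [size_cons] at hs
      omega
    | cons c γ =>
      have hc := c.pos
      have hmem := hp (mem_partialSums_cons.mpr (Or.inr ⟨0, zero_mem_partialSums γ, rfl⟩))
      simp only [mem_partialSums_cons, mem_partialSums_nil, exists_eq_left] at hmem
      simp only [size_cons] at hs
      obtain rfl : c = a := PNat.eq (by omega)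
      cases γ with
      | nil => rfl
      | cons d γ =>
        have hd := d.pos
        simp only [size_cons] at hs
        omega
  · rintro rfl
    exact ⟨rfl, subset_rfl⟩

theorem not_isCoarsening_cons {a b : ℕ+} {l γ : List ℕ+} :
    ¬ IsCoarsening (a :: γ) ((a + b) :: l) := by
  rintro ⟨-, hp⟩
  have ha := a.pos
  have hb := b.pos
  have hmem := hp (mem_partialSums_cons.mpr (Or.inr ⟨0, zero_mem_partialSums γ, rfl⟩))
  rw [mem_partialSums_cons, PNat.add_coe] at hmem
  obtain h | ⟨t, -, h⟩ := hmem <;> omega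

theorem IsCoarsening.ne_nil_and_length_le {γ : List ℕ+} {a : ℕ+} {l : List ℕ+}
    (h : IsCoarsening γ (a :: l)) : γ ≠ [] ∧ γ.length ≤ l.length + 1 := by
  induction l generalizing a γ with
  | nil =>
    rw [isCoarsening_singleton.mp h]
    simp
  | cons b l ih =>
    obtain ⟨γ', h', rfl⟩ | h' := isCoarsening_cons_cons.mp h
    · have := (ih h').2
      simp
      omega
    · have := ih h'
      exact ⟨this.1, by rw [List.length_cons]; omega⟩

theorem sum_coarsenings_cons_cons {M : Type*} [AddCommMonoid M] (a b : ℕ+) (l : List ℕ+)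
    (f : List ℕ+ → M) :
    ∑ γ ∈ (finite_coarsenings (a :: b :: l)).toFinset, f γ =
      ∑ γ ∈ (finite_coarsenings (b :: l)).toFinset, f (a :: γ) +
        ∑ γ ∈ (finite_coarsenings ((a + b) :: l)).toFinset, f γ := by
  classical
  have hinj : Set.InjOn (List.cons a) ((finite_coarsenings (b :: l)).toFinset : Set (List ℕ+)) :=
    fun _ _ _ _ h => (List.cons_inj_right a).mp h
  rw [← Finset.sum_image hinj, ← Finset.sum_union]
  · refine Finset.sum_congr ?_ fun _ _ => rfl
    ext γ
    simp only [Set.Finite.mem_toFinset, Set.mem_ofPred_eq, Finset.mem_union, Finset.mem_image,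
      isCoarsening_cons_cons]
    refine or_congr_left ⟨fun ⟨δ, h, e⟩ => ⟨δ, h, e.symm⟩, fun ⟨δ, h, e⟩ => ⟨δ, h, e.symm⟩⟩
  · rw [Finset.disjoint_left]
    intro γ h1 h2
    obtain ⟨δ, -, rfl⟩ := Finset.mem_image.mp h1
    exact not_isCoarsening_cons (by simpa using h2)

theorem sum_coarsenings_singleton {M : Type*} [AddCommMonoid M] (a : ℕ+) (f : List ℕ+ → M) :
    ∑ γ ∈ (finite_coarsenings [a]).toFinset, f γ = f [a] := by
  have h : (finite_coarsenings [a]).toFinset = {[a]} := by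
    ext γ
    simp [isCoarsening_singleton]
  rw [h, Finset.sum_singleton]

/-! ### Functions of compositions determined by a two-term recursion -/

theorem toRat_injective : Function.Injective toRat :=
  IsFractionRing.injective _ _

theorem yRat_add_zRat_ne_zero : yRat + zRat ≠ 0 := by
  intro h
  have h1 : (MvPolynomial.X 0 + MvPolynomial.X 1 : MvPolynomial (Fin 2) ℤ) = 0 := by
    apply toRat_injective
    rw [toRat, toRat, map_add, map_zero]
    exact h
  have h2 := congrArg (MvPolynomial.eval fun _ => (1 : ℤ)) h1
  simp at h2

/-- `f` satisfies the recursion of the ribbon-like polynomial `H`. -/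
def IsRibbonLike (f : List ℕ+ → RatYZ) : Prop :=
  ∀ a b l, (yRat + zRat) * f (a :: b :: l) =
    yRat * (f [a] + f (b :: l)) + zRat * f ((a + b) :: l)

/-- The recursion lowers the number of parts, and `y + z` can be cancelled. -/
theorem IsRibbonLike.eq {f g : List ℕ+ → RatYZ} (hf : IsRibbonLike f) (hg : IsRibbonLike g)
    (h : ∀ i, f [i] = g [i]) {α : List ℕ+} (hα : α ≠ []) : f α = g α := by
  obtain ⟨a, l, rfl⟩ := List.exists_cons_of_ne_nil hα
  induction l generalizing a with
  | nil => exact h a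
  | cons b l ih =>
    apply mul_left_cancel₀ yRat_add_zRat_ne_zero
    rw [hf, hg, h, ih b (List.cons_ne_nil _ _), ih (a + b) (List.cons_ne_nil _ _)]

/-- Extends the recursion from the cut after the first part to every cut, by induction on the number
of parts before it. -/
theorem IsRibbonLike.append {f : List ℕ+ → RatYZ} (hf : IsRibbonLike f) {α β : List ℕ+}
    (hα : α ≠ []) (hβ : β ≠ []) :
    (yRat + zRat) * f (α ++ β) = yRat * (f α + f β) + zRat * f (nearConcat α β) := by
  obtain ⟨a, l, rfl⟩ := List.exists_cons_of_ne_nil hα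
  obtain ⟨b, m, rfl⟩ := List.exists_cons_of_ne_nil hβ
  induction l generalizing a with
  | nil => exact hf a b m
  | cons c l ih =>
    apply mul_left_cancel₀ yRat_add_zRat_ne_zero
    have i1 := ih c (List.cons_ne_nil _ _)
    have i2 := ih (a + c) (List.cons_ne_nil _ _)
    have r1 := hf a c (l ++ b :: m)
    have r2 := hf a c l
    obtain ⟨d, k, hd⟩ := List.exists_cons_of_ne_nil
      (nearConcat_ne_nil (List.cons_ne_nil c l) (List.cons_ne_nil b m))
    -- By associativity this is `[a] ⊙ (d :: k)`, so the recursion at the cut after `a` applies to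
    -- `a :: d :: k`.
    have hk : nearConcat ((a + c) :: l) (b :: m) = (a + d) :: k := by
      have e1 : (a + c) :: l = nearConcat [a] (c :: l) := rfl
      rw [e1, ← nearConcat_assoc (List.cons_ne_nil _ _) (List.cons_ne_nil _ _)
        (List.cons_ne_nil _ _), hd]
      rfl
    have r3 := hf a d k
    rw [← hd, ← hk] at r3
    simp only [List.cons_append] at i1 i2 r1 ⊢
    change _ = (yRat + zRat) * (_ + zRat * f (a :: nearConcat (c :: l) (b :: m)))
    linear_combination (yRat + zRat) * r1 + yRat * i1 + zRat * i2 - yRat * r2 - zRat * r3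

/-- The recursion at the last cut of `α.reverse` mirrors the one at the first cut of `α`. -/
theorem IsRibbonLike.reverse {f : List ℕ+ → RatYZ} (hf : IsRibbonLike f) {α : List ℕ+}
    (hα : α ≠ []) : f α.reverse = f α := by
  obtain ⟨a, l, rfl⟩ := List.exists_cons_of_ne_nil hα
  induction l generalizing a with
  | nil => rfl
  | cons b l ih =>
    apply mul_left_cancel₀ yRat_add_zRat_ne_zero
    have hne : (b :: l).reverse ≠ [] := by simp
    have hn : nearConcat (b :: l).reverse [a] = ((a + b) :: l).reverse := by
      simp [nearConcat_concat_cons, add_comm]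
    rw [List.reverse_cons, hf.append hne (List.cons_ne_nil _ _), hn, ih b (List.cons_ne_nil _ _),
      ih (a + b) (List.cons_ne_nil _ _), hf]
    ring

theorem IsRibbonLike.compose {f : List ℕ+ → RatYZ} (hf : IsRibbonLike f) {β : List ℕ+}
    (hβ : β ≠ []) : IsRibbonLike fun α => f (compose α β) := by
  intro a b l
  have h := hf.append (nearPow_ne_nil hβ a) (compose_ne_nil (List.cons_ne_nil b l) hβ)
  rw [nearPow_nearConcat_compose hβ] at h
  simpa only [compose_cons a (b :: l), compose_singleton] using h

/-! ### `H` as a solution of the recursion. -/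

theorem eval_H (x : ℕ+ → RatYZ) (α : List ℕ+) :
    MvPolynomial.eval x (H α) = ∑ γ ∈ (finite_coarsenings α).toFinset,
      yRat ^ (γ.length - 1) * zRat ^ (α.length - γ.length) / (yRat + zRat) ^ (α.length - 1) *
        (γ.map x).sum := by
  rw [H, map_sum]
  refine Finset.sum_congr rfl fun γ _ => ?_
  rw [map_mul, MvPolynomial.eval_C, map_list_sum, List.map_map]
  congr 3
  exact funext fun i => MvPolynomial.eval_X i

theorem eval_H_singleton (x : ℕ+ → RatYZ) (a : ℕ+) : MvPolynomial.eval x (H [a]) = x a := by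
  rw [eval_H, sum_coarsenings_singleton]
  simp

/-- The coefficient of a coarsening `γ` in `H(α)`. -/
noncomputable def coarseningCoeff (α γ : List ℕ+) : RatYZ :=
  yRat ^ (γ.length - 1) * zRat ^ (α.length - γ.length) / (yRat + zRat) ^ (α.length - 1)

theorem coarseningCoeff_cons {a b : ℕ+} {l γ : List ℕ+} (h : IsCoarsening γ (b :: l)) :
    (yRat + zRat) * coarseningCoeff (a :: b :: l) (a :: γ) =
      yRat * coarseningCoeff (b :: l) γ := by
  obtain ⟨c, δ, rfl⟩ := List.exists_cons_of_ne_nil h.ne_nil_and_length_le.1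
  have hs := yRat_add_zRat_ne_zero
  simp only [coarseningCoeff, List.length_cons, Nat.add_sub_cancel, Nat.add_sub_add_right, pow_succ]
  field_simp

theorem coarseningCoeff_merge {a b : ℕ+} {l γ : List ℕ+} (h : IsCoarsening γ ((a + b) :: l)) :
    (yRat + zRat) * coarseningCoeff (a :: b :: l) γ =
      zRat * coarseningCoeff ((a + b) :: l) γ := by
  have hle := h.ne_nil_and_length_le.2
  have hs := yRat_add_zRat_ne_zero
  simp only [coarseningCoeff, List.length_cons, Nat.add_sub_cancel]
  rw [Nat.succ_sub hle, pow_succ, pow_succ]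
  field_simp

/-- Formally, each cut of the composition is kept with probability `y / (y + z)` and removed with
probability `z / (y + z)`, independently; the coefficients are the resulting probabilities. -/
theorem sum_coarseningCoeff (a : ℕ+) (l : List ℕ+) :
    ∑ γ ∈ (finite_coarsenings (a :: l)).toFinset, coarseningCoeff (a :: l) γ = 1 := by
  induction l generalizing a with
  | nil =>
    rw [sum_coarsenings_singleton]
    simp [coarseningCoeff]
  | cons b l ih =>
    apply mul_left_cancel₀ yRat_add_zRat_ne_zero
    rw [sum_coarsenings_cons_cons, mul_add, Finset.mul_sum, Finset.mul_sum,
      Finset.sum_congr rfl fun γ hγ => coarseningCoeff_cons (by simpa using hγ),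
      Finset.sum_congr rfl fun γ hγ => coarseningCoeff_merge (a := a) (b := b) (by simpa using hγ),
      ← Finset.mul_sum, ← Finset.mul_sum, ih, ih]
    ring

theorem isRibbonLike_eval_H (x : ℕ+ → RatYZ) :
    IsRibbonLike fun α => MvPolynomial.eval x (H α) := by
  intro a b l
  have h : ∀ α, MvPolynomial.eval x (H α) = ∑ γ ∈ (finite_coarsenings α).toFinset,
      coarseningCoeff α γ * (γ.map x).sum := eval_H x
  simp only [eval_H_singleton]
  rw [h, h, h, sum_coarsenings_cons_cons, mul_add, Finset.mul_sum, Finset.mul_sum]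
  -- Every coarsening that keeps the first cut brings its own `x a`; as the coefficients sum to `1`,
  -- these add up to the single `y * x a` of the recursion.
  have h1 : ∀ γ ∈ (finite_coarsenings (b :: l)).toFinset,
      (yRat + zRat) * (coarseningCoeff (a :: b :: l) (a :: γ) * ((a :: γ).map x).sum) =
      yRat * x a * coarseningCoeff (b :: l) γ +
        yRat * (coarseningCoeff (b :: l) γ * (γ.map x).sum) := by
    intro γ hγ
    rw [← mul_assoc, coarseningCoeff_cons (by simpa using hγ), List.map_cons, List.sum_cons]
    ring
  have h2 : ∀ γ ∈ (finite_coarsenings ((a + b) :: l)).toFinset,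
      (yRat + zRat) * (coarseningCoeff (a :: b :: l) γ * (γ.map x).sum) =
      zRat * (coarseningCoeff ((a + b) :: l) γ * (γ.map x).sum) := by
    intro γ hγ
    rw [← mul_assoc, coarseningCoeff_merge (by simpa using hγ), mul_assoc]
  rw [Finset.sum_congr rfl h1, Finset.sum_congr rfl h2, Finset.sum_add_distrib, ← Finset.mul_sum,
    ← Finset.mul_sum, ← Finset.mul_sum, sum_coarseningCoeff]
  ring

/-- As functions of `α`, both sides solve the recursion, so one-part `α` suffice. -/
theorem eval_H_compose (x : ℕ+ → RatYZ) {α β : List ℕ+} (hα : α ≠ []) (hβ : β ≠ []) :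
    MvPolynomial.eval x (H (compose α β)) =
      MvPolynomial.eval (fun i => MvPolynomial.eval x (H (nearPow β i))) (H α) := by
  refine ((isRibbonLike_eval_H x).compose hβ).eq (isRibbonLike_eval_H _) (fun i => ?_) hα
  simp only [eval_H_singleton, compose_singleton]

/-- Reverse the whole composition, then reverse the outer factor back inside `eval_H_compose`. -/
theorem eval_H_compose_reverse (x : ℕ+ → RatYZ) {α β : List ℕ+} (hα : α ≠ []) (hβ : β ≠ []) :
    MvPolynomial.eval x (H (compose α β.reverse)) = MvPolynomial.eval x (H (compose α β)) := by
  have hα' : α.reverse ≠ [] := by simpa using hα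
  have h : compose α β.reverse = (compose α.reverse β).reverse := by
    rw [compose_reverse _ hβ, List.reverse_reverse]
  rw [h, (isRibbonLike_eval_H x).reverse (compose_ne_nil hα' hβ), eval_H_compose x hα' hβ,
    eval_H_compose x hα hβ, (isRibbonLike_eval_H _).reverse hα]

theorem forall_ne_nil_of_forall₂ {F G : List (List ℕ+)} (hF : ∀ φ ∈ F, φ ≠ [])
    (h : List.Forall₂ (fun φ ψ => ψ = φ ∨ ψ = φ.reverse) F G) : ∀ ψ ∈ G, ψ ≠ [] := by
  induction h with
  | nil => simp
  | cons h0 _ ih =>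
    rw [List.forall_mem_cons] at hF ⊢
    refine ⟨?_, ih hF.2⟩
    rcases h0 with rfl | rfl
    · exact hF.1
    · simpa using hF.1

/-- The prefix `α` grows in the induction. The tail is switched behind `α ∘ φ`; then it is absorbed
into the values of the variables, which leaves `φ` as the innermost factor, ready to be reversed. -/
theorem eval_H_compose_composeAll (x : ℕ+ → RatYZ) {F G : List (List ℕ+)}
    (hF : ∀ φ ∈ F, φ ≠ []) (h : List.Forall₂ (fun φ ψ => ψ = φ ∨ ψ = φ.reverse) F G)
    {α : List ℕ+} (hα : α ≠ []) :
    MvPolynomial.eval x (H (compose α (composeAll F))) =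
      MvPolynomial.eval x (H (compose α (composeAll G))) := by
  induction h generalizing α with
  | nil => rfl
  | @cons φ ψ F G h0 hFG ih =>
    rw [List.forall_mem_cons] at hF
    have hG := composeAll_ne_nil (forall_ne_nil_of_forall₂ hF.2 hFG)
    have hψ : ψ ≠ [] := by
      rcases h0 with rfl | rfl
      · exact hF.1
      · simpa using hF.1
    change MvPolynomial.eval x (H (TreeHDP.compose α (TreeHDP.compose φ (composeAll F)))) =
      MvPolynomial.eval x (H (TreeHDP.compose α (TreeHDP.compose ψ (composeAll G))))
    rw [← compose_assoc α hF.1 (composeAll_ne_nil hF.2), ← compose_assoc α hψ hG,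
      ih hF.2 (compose_ne_nil hα hF.1), eval_H_compose x (compose_ne_nil hα hF.1) hG,
      eval_H_compose x (compose_ne_nil hα hψ) hG]
    rcases h0 with rfl | rfl
    · rfl
    · rw [eval_H_compose_reverse _ hα hF.1]

theorem size_composeAll_eq {F G : List (List ℕ+)} (hF : ∀ φ ∈ F, φ ≠ [])
    (h : List.Forall₂ (fun φ ψ => ψ = φ ∨ ψ = φ.reverse) F G) :
    size (composeAll F) = size (composeAll G) ∧
      (composeAll F).length = (composeAll G).length := by
  induction h with
  | nil => exact ⟨rfl, rfl⟩
  | @cons φ ψ F G h0 hFG ih =>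
    rw [List.forall_mem_cons] at hF
    obtain ⟨i1, i2⟩ := ih hF.2
    obtain ⟨a1, a2⟩ := size_compose φ (composeAll_ne_nil hF.2)
    obtain ⟨b1, b2⟩ := size_compose ψ
      (composeAll_ne_nil (forall_ne_nil_of_forall₂ hF.2 hFG))
    have hψ : size ψ = size φ ∧ ψ.length = φ.length := by
      rcases h0 with rfl | rfl
      · exact ⟨rfl, rfl⟩
      · exact ⟨size_reverse _, List.length_reverse⟩
    rw [hψ.1, ← i1] at b1
    rw [hψ.1, hψ.2, ← i2] at b2
    exact ⟨a1.trans b1.symm, Nat.add_right_cancel (a2.trans b2.symm)⟩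

theorem IsSwitch.invariants {α β : List ℕ+} (h : IsSwitch α β) :
    β ≠ [] ∧ size β = size α ∧ β.length = α.length ∧
      ∀ x : ℕ+ → RatYZ, MvPolynomial.eval x (H α) = MvPolynomial.eval x (H β) := by
  obtain ⟨F, G, ⟨rfl, hF, -⟩, hFG, rfl⟩ := h
  have hne : ∀ φ ∈ F, φ ≠ [] := fun φ hφ => (hF.1 φ hφ).1
  obtain ⟨h1, h2⟩ := size_composeAll_eq hne hFG
  refine ⟨composeAll_ne_nil (forall_ne_nil_of_forall₂ hne hFG), h1.symm, h2.symm, fun x => ?_⟩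
  -- The prefix `[1]` is the identity for `∘`.
  have h3 := eval_H_compose_composeAll x hne hFG (List.cons_ne_nil 1 [])
  rwa [compose_singleton, compose_singleton, nearPow_one, nearPow_one] at h3

theorem toRat_modifiedHdp_framed_compose {T : PolarizedGraph.{u}} (hT : T.graph.IsTree)
    {α : List ℕ+} (hα : α ≠ []) :
    toRat (modifiedHdp (T.compose α).framed.graph) =
      MvPolynomial.eval (fun i : ℕ+ => toRat (modifiedHdp (T.nearPow i).framed.graph)) (H α) := by
  refine IsRibbonLike.eq (f := fun α => toRat (modifiedHdp (T.compose α).framed.graph))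
    (fun a b l => ?_) (isRibbonLike_eval_H _) (fun i => ?_) hα
  · have h := congrArg toRat (PolarizedGraph.modifiedHdp_framed_compose hT a b l)
    simp only [toRat, map_mul, map_add] at h
    exact h
  · rw [eval_H_singleton]
    rfl

end TreeHDP

theorem theorem7p1 (T : PolarizedGraph.{u}) (hT : T.graph.IsTree) (α : List ℕ+) (hα : α ≠ []) :
    toRat (modifiedHdp (T.compose α).framed.graph) =
        MvPolynomial.eval (fun i : ℕ+ => toRat (modifiedHdp (T.nearPow i).framed.graph)) (H α) ∧
      ∀ β : List ℕ+, IsSwitch α β →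
        hdp (T.compose α).framed.graph = hdp (T.compose β).framed.graph := by
  refine ⟨toRat_modifiedHdp_framed_compose hT hα, fun β h => ?_⟩
  obtain ⟨hβ, hs, hl, hH⟩ := h.invariants
  rw [PolarizedGraph.hdp_framed_compose hT hα, PolarizedGraph.hdp_framed_compose hT hβ, hs, hl]
  -- Sum and number of parts agree, so the leaf terms coincide and only the modified polynomials
  -- remain.
  congr 1
  apply toRat_injective
  rw [toRat_modifiedHdp_framed_compose hT hα, toRat_modifiedHdp_framed_compose hT hβ, hH]
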